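/- Let $\phi$ be a real polynomial with $\phi''(x)\neq 0$ for all $x\in[-1,1]$. For $n\ge 1$ let $K_n\subset\mathbb Z$ be a finite set of levels, $d_n=|K_n|$, and let $\hat I$ be the diagonal (action) operator on $\mathbb C^{K_n}$ with eigenvalues $k/n$, $k\in K_n$. For $(\alpha,\beta)\in\mathbb R^2$ let $U_{n,\alpha,\beta}=e^{in(\alpha\phi(\hat I)+\beta\hat I)}$. Its pair correlation function is $$\rho_{2,\alpha,\beta}^n(f)=\frac1{d_n^2}\sum_{\ell\in\mathbb Z}\hat f\Big(\frac{\ell}{d_n}\Big)\,\big|\operatorname{Tr}U_{n,\alpha,\beta}^{\ell}\big|^2 =\frac1{d_n^2}\sum_{\ell\in\mathbb Z}\hat f\Big(\frac{\ell}{d_n}\Big)\Big|\sum_{k\in K_n}e^{i\ell n[\alpha\phi(k/n)+\beta k/n]}\Big|^2,\qquad \hat f(\xi)=\int_{\mathbb R} f(x)e^{-2\pi i x\xi}\,dx ,$$ for continuous integrable $f:\mathbb R\to\mathbb C$ such that $\hat f$ has compact support. As a measure it is $$\rho_{2,\alpha,\beta}^n=\frac1{d_n}\sum_{j,k\in K_n}\sum_{m\in\mathbb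 Z}\delta_{d_n(\theta_j-\theta_k+m)},\qquad \theta_k=\frac{n}{2\pi}\Big(\alpha\phi\Big(\frac kn\Big)+\beta\frac kn\Big).$$ Let $\bar\rho_{2,\alpha,\beta}^N=\frac1N\sum_{n=1}^N\rho_{2,\alpha,\beta}^n$, and let $\rho_2^{POISSON}=\delta_0+dx$ on $\mathbb R$. Theorem. Let $K_n=\{1,\dots,n\}$ for all $n$, or let $K_n=\{-n,\dots,n\}$ for all $n$. Then for Lebesgue-almost every $(\alpha,\beta)\in\mathbb R^2$ one has $\bar\rho_{2,\alpha,\beta}^N\to\rho_2^{POISSON}$ as $N\to\infty$ along the full sequence of integers, in the following sense: 1. $\bar\rho_{2,\alpha,\beta}^N(f)\to f(0)+\int_{\mathbb R}f(x)\,dx$ for every continuous integrable $f:\mathbb R\to\mathbb C$ whose Fourier transform has compact support; 2. $\bar\rho_{2,\alpha,\beta}^N([a,b])\to\rho_2^{POISSON}([a,b])$ for every compact interval $[a,b]$. The exceptional null set of $(\alpha,\beta)$ does not depend on $f$ or on $[a,b]$. -/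

import Mathlib

open Filter Topology MeasureTheory

namespace QuantumMap

noncomputable section

/-- The levels `k = 1, …, n`. -/
def positiveLevels (n : ℕ) : Finset ℤ := Finset.Icc 1 (n : ℤ)

/-- The levels `k = -n, …, n` (angular momentum on the spherical harmonics of degree `n`). -/
def allLevels (n : ℕ) : Finset ℤ := Finset.Icc (-(n : ℤ)) (n : ℤ)

/-- The action operator at Planck constant `1 / n` with levels `K`, written in its eigenbasis:
its eigenvalues are `k / n`, `k ∈ K`. -/
def actionOperator (n : ℕ) (K : Finset ℤ) : Matrix K K ℂ :=
  Matrix.diagonal fun k => ((k : ℤ) : ℂ) / (n : ℂ)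

/-- The quantum map `U = exp (i n (α φ(I) + β I))`, where `I` is the action operator. -/
def quantumMap (φ : Polynomial ℝ) (α β : ℝ) (n : ℕ) (K : Finset ℤ) : Matrix K K ℂ :=
  NormedSpace.exp ((Complex.I * (n : ℂ)) •
    ((α : ℂ) • Polynomial.aeval (actionOperator n K) φ + (β : ℂ) • actionOperator n K))

/-- The pair correlation function at level `n`, as a functional of a test function `f`:
`ρ(f) = d⁻² ∑_ℓ f̂(ℓ / d) |Tr U ^ ℓ|²`, where `d` is the dimension (the number of levels) and
`f̂(ξ) = ∫ f(x) exp(-2π i x ξ) dx`. -/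
def pairCorrelation (φ : Polynomial ℝ) (α β : ℝ) (n : ℕ) (K : Finset ℤ) (f : ℝ → ℂ) : ℂ :=
  (1 / (K.card : ℂ) ^ 2) * ∑' ℓ : ℤ,
    FourierTransform.fourier f ((ℓ : ℝ) / (K.card : ℝ)) *
      ((‖(quantumMap φ α β n K ^ ℓ).trace‖ ^ 2 : ℝ) : ℂ)

/-- The averaged pair correlation function `(1 / N) ∑_{n = 1}^N ρ^n`. -/
def averagedPairCorrelation (φ : Polynomial ℝ) (α β : ℝ) (K : ℕ → Finset ℤ) (N : ℕ)
    (f : ℝ → ℂ) : ℂ :=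
  (1 / (N : ℂ)) * ∑ n ∈ Finset.Icc 1 N, pairCorrelation φ α β n (K n) f

/-- The eigenphase of the quantum map at the level `k`, in units of `2π`: the corresponding
eigenvalue is `exp (2π i θ)` with `θ = n (α φ(k / n) + β k / n) / (2π)`. -/
def eigenphase (φ : Polynomial ℝ) (α β : ℝ) (n : ℕ) (k : ℤ) : ℝ :=
  (n : ℝ) * (α * φ.eval ((k : ℝ) / (n : ℝ)) + β * ((k : ℝ) / (n : ℝ))) / (2 * Real.pi)

/-- The pair correlation function at level `n` as a measure: the normalized counting measure
`d⁻¹ ∑_{j, k} ∑_m δ(d (θ_j - θ_k + m))` of the differences of eigenphases modulo `1`, rescaled to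
unit mean level spacing (the pairs with `j = k` are included). -/
def pairCorrelationMeasure (φ : Polynomial ℝ) (α β : ℝ) (n : ℕ) (K : Finset ℤ) : Measure ℝ :=
  (K.card : ENNReal)⁻¹ • ∑ j ∈ K, ∑ k ∈ K, Measure.sum fun m : ℤ =>
    Measure.dirac ((K.card : ℝ) * (eigenphase φ α β n j - eigenphase φ α β n k + (m : ℝ)))

/-- The averaged pair correlation measure `(1 / N) ∑_{n = 1}^N ρ^n`. -/
def averagedPairCorrelationMeasure (φ : Polynomial ℝ) (α β : ℝ) (K : ℕ → Finset ℤ) (N : ℕ) :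
    Measure ℝ :=
  (N : ENNReal)⁻¹ • ∑ n ∈ Finset.Icc 1 N, pairCorrelationMeasure φ α β n (K n)

/-- The Poisson pair correlation `δ₀ + dx`; the atom at `0` comes from the diagonal pairs. -/
def poissonPairCorrelation : Measure ℝ := Measure.dirac 0 + volume

/-- The averaged pair correlation functions converge, as `N → ∞` through all integers, to the
Poisson pair correlation: tested against all continuous integrable `f` whose Fourier transform has
compact support, and on all compact intervals. -/
def ConvergesToPoisson (φ : Polynomial ℝ) (K : ℕ → Finset ℤ) (α β : ℝ) : Prop :=
  (∀ f : ℝ → ℂ, Continuous f → Integrable f → HasCompactSupport (FourierTransform.fourier f) →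
    Tendsto (fun N : ℕ => averagedPairCorrelation φ α β K N f) atTop
      (𝓝 (∫ x, f x ∂poissonPairCorrelation))) ∧
  (∀ a b : ℝ,
    Tendsto (fun N : ℕ => averagedPairCorrelationMeasure φ α β K N (Set.Icc a b)) atTop
      (𝓝 (poissonPairCorrelation (Set.Icc a b))))

end

end QuantumMap

open Filter Topology MeasureTheory

namespace QuantumMap

noncomputable section

/-! Let d be the number of levels and T_ℓ = |Tr U^ℓ|². The term ℓ = 0 contributes f̂(0) = ∫ f. If
every other T_ℓ is replaced by d, its contribution from equal levels, what remains is a Riemann sum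
for ∫ f̂ = f(0), up to its own term ℓ = 0, which is O(1/d). It remains to show that the fluctuation
X_n = ∑ f̂(ℓ/d) (T_ℓ - d), over 0 < |ℓ| ≪ n, is o(n²) on average over n.

This follows from a second moment in (α, β). Expand T_ℓ - d over pairs of levels k + h, k with h ≠
0. In the linear term n cancels, so β enters only through exp(iβℓh). Parseval in β over whole
periods (`integral_norm_sum_sq`) separates the values of ℓh, and each value is taken a
divisor-bounded number of times. In α, the remaining sum over k has frequencies separated by at
least c|ℓh||k - k'|/n, because φ'' does not vanish (`le_abs_second_difference`). Its mean square is
therefore O(n + n² log n / |ℓh|). Summing over ℓ and h gives ∫ |X_n|² ≪ n^(7/2) on every box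
(`exists_lintegral_formFactorFluctuation_le`), a power below n⁴.

Consequently ∑ |X_n|² / n⁵ converges almost everywhere. Kronecker's lemma and Cauchy–Schwarz then
make the Cesàro means of |X_n| / n² tend to 0 along the full sequence
(`ae_tendsto_average_norm_div_sq`). Separability of the space of weights yields a single null set
(`ae_fluctuationsVanish`).

For intervals, Poisson summation identifies the functional with the measure
(`integral_pairCorrelationMeasure`). Multiplying by a nonnegative band-limited g, positive on a
large interval, makes the measures finite with convergent characteristic functions, so Lévy's
theorem gives vague convergence. An interval with endpoint 0 needs one further fact: each averaged
measure already has mass at least 1 at 0. -/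

/-! ### Traces of powers of the quantum map as exponential sums -/

/-- The phase `n (α φ(k / n) + β k / n)` of the eigenvalue at the level `k`. -/
def levelPhase (φ : Polynomial ℝ) (α β : ℝ) (n : ℕ) (k : ℤ) : ℝ :=
  (n : ℝ) * (α * φ.eval ((k : ℝ) / (n : ℝ)) + β * ((k : ℝ) / (n : ℝ)))

/-- The exponential sum `∑ₖ exp (i ℓ n (α φ(k / n) + β k / n))`. -/
def expSum (φ : Polynomial ℝ) (α β : ℝ) (n : ℕ) (K : Finset ℤ) (ℓ : ℤ) : ℂ :=
  ∑ k ∈ K, Complex.exp (Complex.I * ((ℓ * levelPhase φ α β n k : ℝ) : ℂ))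

theorem aeval_actionOperator (φ : Polynomial ℝ) (n : ℕ) (K : Finset ℤ) :
    Polynomial.aeval (actionOperator n K) φ =
      Matrix.diagonal fun k : K => ((φ.eval ((k : ℝ) / (n : ℝ)) : ℝ) : ℂ) := by
  have h1 := Polynomial.aeval_algHom_apply (Matrix.diagonalAlgHom (n := K) (α := ℂ) ℝ)
    (fun k : K => ((k : ℤ) : ℂ) / (n : ℂ)) φ
  simp only [Matrix.diagonalAlgHom_apply] at h1
  rw [actionOperator, h1]
  congr 1
  funext k
  have h2 := Polynomial.aeval_algHom_apply (Pi.evalAlgHom ℝ (fun _ : K => ℂ) k)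
    (fun k : K => ((k : ℤ) : ℂ) / (n : ℂ)) φ
  simp only [Pi.evalAlgHom_apply] at h2
  rw [← h2]
  have h3 := Polynomial.aeval_algebraMap_apply ℂ ((k : ℝ) / (n : ℝ)) φ
  simpa using h3

theorem trace_quantumMap_zpow (φ : Polynomial ℝ) (α β : ℝ) (n : ℕ) (K : Finset ℤ) (ℓ : ℤ) :
    (quantumMap φ α β n K ^ ℓ).trace = expSum φ α β n K ℓ := by
  have h : (ℓ • ((Complex.I * (n : ℂ)) •
      ((α : ℂ) • Polynomial.aeval (actionOperator n K) φ + (β : ℂ) • actionOperator n K))) =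
      Matrix.diagonal fun k : K => Complex.I * ((ℓ * levelPhase φ α β n k : ℝ) : ℂ) := by
    rw [aeval_actionOperator, actionOperator]
    ext i j
    by_cases hij : i = j
    · subst hij
      simp [levelPhase]
      ring
    · simp [hij]
  rw [quantumMap, ← Matrix.exp_zsmul, h, Matrix.exp_diagonal, Matrix.trace_diagonal, expSum,
    ← Finset.sum_coe_sort K]
  refine Finset.sum_congr rfl fun k _ => ?_
  rw [Pi.coe_exp, Complex.exp_eq_exp_ℂ]

/-! ### Mean squares of exponential sums -/

theorem norm_sum_sq_eq {ι : Type*} (s : Finset ι) (z : ι → ℂ) :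
    ((‖∑ i ∈ s, z i‖ ^ 2 : ℝ) : ℂ) = ∑ i ∈ s, ∑ j ∈ s, z i * (starRingEnd ℂ) (z j) := by
  rw [Complex.ofReal_pow, ← Complex.mul_conj', map_sum, Finset.sum_mul_sum]

theorem exp_I_mul_mul_conj (x y : ℝ) :
    Complex.exp (Complex.I * (x : ℂ)) * (starRingEnd ℂ) (Complex.exp (Complex.I * (y : ℂ))) =
      Complex.exp (Complex.I * ((x - y : ℝ) : ℂ)) := by
  rw [← Complex.exp_conj, ← Complex.exp_add]
  congr 1
  simp
  ring

theorem norm_exp_I_mul (x : ℝ) : ‖Complex.exp (Complex.I * (x : ℂ))‖ = 1 := by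
  rw [mul_comm, Complex.norm_exp_ofReal_mul_I]

/-- The interval has length 2πm, a whole number of periods for every integer frequency, so nonzero
frequencies integrate to exactly zero. -/
theorem integral_exp_I_mul_int (m : ℕ) (A : ℤ) :
    ∫ β in (-(Real.pi * m))..(Real.pi * m), Complex.exp (Complex.I * ((β * A : ℝ) : ℂ)) =
      if A = 0 then ((2 * Real.pi * m : ℝ) : ℂ) else 0 := by
  split_ifs with h
  · simp [h]
    ring
  · have hc : Complex.I * (A : ℂ) ≠ 0 := mul_ne_zero Complex.I_ne_zero (by exact_mod_cast h)
    have h1 : ∀ β : ℝ, Complex.exp (Complex.I * ((β * A : ℝ) : ℂ)) =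
        Complex.exp ((Complex.I * (A : ℂ)) * β) := by
      intro β; congr 1; push_cast; ring
    simp_rw [h1]
    rw [integral_exp_mul_complex hc, div_eq_zero_iff]
    left
    rw [sub_eq_zero, Complex.exp_eq_exp_iff_exists_int]
    refine ⟨A * m, ?_⟩
    push_cast
    ring

theorem norm_integral_exp_I_mul_le (R x : ℝ) (hx : x ≠ 0) :
    ‖∫ α in (-R)..R, Complex.exp (Complex.I * ((α * x : ℝ) : ℂ))‖ ≤ 2 / |x| := by
  have hc : Complex.I * (x : ℂ) ≠ 0 := mul_ne_zero Complex.I_ne_zero (by exact_mod_cast hx)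
  have h1 : ∀ α : ℝ, Complex.exp (Complex.I * ((α * x : ℝ) : ℂ)) =
      Complex.exp ((Complex.I * (x : ℂ)) * α) := by
    intro α; congr 1; push_cast; ring
  have h2 : ∀ α : ℝ, ‖Complex.exp ((Complex.I * (x : ℂ)) * α)‖ = 1 := fun α => by
    rw [← h1, norm_exp_I_mul]
  simp_rw [h1]
  rw [integral_exp_mul_complex hc, norm_div]
  simp only [norm_mul, Complex.norm_I, one_mul, Complex.norm_real, Real.norm_eq_abs]
  gcongr
  calc _ ≤ _ := norm_sub_le _ _
    _ = 2 := by rw [h2, h2]; norm_num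

/-- Parseval's identity. Frequencies may coincide, so coefficients sharing a frequency are added
before squaring. -/
theorem integral_norm_sum_sq {ι : Type*} (s : Finset ι) (A : ι → ℤ) (a : ι → ℂ) (m : ℕ) :
    ∫ β in (-(Real.pi * m))..(Real.pi * m),
        ‖∑ i ∈ s, a i * Complex.exp (Complex.I * ((β * A i : ℝ) : ℂ))‖ ^ 2 =
      2 * Real.pi * m * ∑ B ∈ s.image A, ‖∑ i ∈ s with A i = B, a i‖ ^ 2 := by
  apply Complex.ofReal_injective
  rw [← intervalIntegral.integral_ofReal]
  simp_rw [norm_sum_sq_eq]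
  have h1 : ∀ β : ℝ, ∀ i j : ι, a i * Complex.exp (Complex.I * ((β * A i : ℝ) : ℂ)) *
      (starRingEnd ℂ) (a j * Complex.exp (Complex.I * ((β * A j : ℝ) : ℂ))) =
      a i * (starRingEnd ℂ) (a j) * Complex.exp (Complex.I * ((β * (A i - A j : ℤ) : ℝ) : ℂ)) := by
    intro β i j
    have := exp_I_mul_mul_conj (β * A i) (β * A j)
    rw [map_mul, show (β * (A i - A j : ℤ) : ℝ) = β * A i - β * A j by push_cast; ring, ← this]
    ring
  simp_rw [h1]
  rw [intervalIntegral.integral_finsetSum]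
  swap
  · intro i _
    apply Continuous.intervalIntegrable
    fun_prop
  have h2 : ∀ i ∈ s, (∫ β in (-(Real.pi * m))..(Real.pi * m), ∑ j ∈ s,
      a i * (starRingEnd ℂ) (a j) * Complex.exp (Complex.I * ((β * (A i - A j : ℤ) : ℝ) : ℂ))) =
      ∑ j ∈ s, a i * (starRingEnd ℂ) (a j) *
        if A i - A j = 0 then ((2 * Real.pi * m : ℝ) : ℂ) else 0 := by
    intro i _
    rw [intervalIntegral.integral_finsetSum]
    swap
    · intro i _
      apply Continuous.intervalIntegrable
      fun_prop
    refine Finset.sum_congr rfl fun j _ => ?_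
    rw [intervalIntegral.integral_const_mul, integral_exp_I_mul_int]
  rw [Finset.sum_congr rfl h2, Complex.ofReal_mul (2 * Real.pi * m), Complex.ofReal_sum]
  simp_rw [norm_sum_sq_eq]
  rw [← Finset.sum_fiberwise_of_maps_to (g := A) (t := s.image A)
    (fun i hi => Finset.mem_image_of_mem A hi), Finset.mul_sum]
  refine Finset.sum_congr rfl fun B _ => ?_
  rw [Finset.mul_sum]
  refine Finset.sum_congr rfl fun i hi => ?_
  rw [Finset.mul_sum, Finset.sum_filter]
  refine Finset.sum_congr rfl fun j hj => ?_
  have hiB : A i = B := (Finset.mem_filter.1 hi).2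
  by_cases h : A j = B
  · rw [if_pos h, if_pos (by rw [hiB, h, sub_self])]
    ring
  · rw [if_neg h, if_neg (fun h' => h (by rw [← hiB]; exact (sub_eq_zero.1 h').symm)), mul_zero]

/-- For real frequencies orthogonality is only approximate: diagonal pairs contribute the length 2R
each, and the others are bounded through the primitive, uniformly in R. -/
theorem integral_norm_sum_exp_sq_le {ι : Type*} [DecidableEq ι] (s : Finset ι) (x : ι → ℝ)
    (hx : Set.InjOn x s) {R : ℝ} (hR : 0 ≤ R) :
    ∫ α in (-R)..R, ‖∑ i ∈ s, Complex.exp (Complex.I * ((α * x i : ℝ) : ℂ))‖ ^ 2 ≤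
      2 * R * s.card + ∑ p ∈ s.offDiag, 2 / |x p.1 - x p.2| := by
  have h1 : ∀ α : ℝ, ((‖∑ i ∈ s, Complex.exp (Complex.I * ((α * x i : ℝ) : ℂ))‖ ^ 2 : ℝ) : ℂ) =
      ∑ p ∈ s ×ˢ s, Complex.exp (Complex.I * ((α * (x p.1 - x p.2) : ℝ) : ℂ)) := by
    intro α
    rw [norm_sum_sq_eq, Finset.sum_product]
    refine Finset.sum_congr rfl fun i _ => Finset.sum_congr rfl fun j _ => ?_
    rw [exp_I_mul_mul_conj, mul_sub]
  have h0 : 0 ≤ ∫ α in (-R)..R, ‖∑ i ∈ s, Complex.exp (Complex.I * ((α * x i : ℝ) : ℂ))‖ ^ 2 :=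
    intervalIntegral.integral_nonneg (by linarith) fun _ _ => by positivity
  rw [← abs_of_nonneg h0, ← Real.norm_eq_abs, ← Complex.norm_real,
    ← intervalIntegral.integral_ofReal]
  simp_rw [h1]
  rw [intervalIntegral.integral_finsetSum]
  swap
  · intro i _
    apply Continuous.intervalIntegrable
    fun_prop
  refine (norm_sum_le _ _).trans ?_
  rw [← Finset.diag_union_offDiag, Finset.sum_union (Finset.disjoint_diag_offDiag s)]
  gcongr with p hp
  · rw [Finset.sum_diag]
    simp only [sub_self, mul_zero, Complex.ofReal_zero, Complex.exp_zero]
    simp only [intervalIntegral.integral_const, sub_neg_eq_add, Finset.sum_const, nsmul_eq_mul]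
    rw [norm_smul, norm_one, mul_one, Real.norm_eq_abs, abs_of_nonneg (by linarith)]
    apply le_of_eq
    ring
  · obtain ⟨h1, h2, h3⟩ := Finset.mem_offDiag.1 hp
    exact norm_integral_exp_I_mul_le R _ (sub_ne_zero.2 fun h => h3 (hx h1 h2 h))

/-! ### Lower bound for second differences of φ -/

theorem exists_le_abs_derivative_derivative {φ : Polynomial ℝ}
    (hφ : ∀ x ∈ Set.Icc (-1 : ℝ) 1, φ.derivative.derivative.eval x ≠ 0) :
    ∃ c : ℝ, 0 < c ∧ ∀ x ∈ Set.Icc (-1 : ℝ) 1, c ≤ |φ.derivative.derivative.eval x| := by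
  obtain ⟨x, hx, hm⟩ := (isCompact_Icc (a := (-1 : ℝ)) (b := 1)).exists_isMinOn
    ⟨0, by norm_num⟩ (f := fun x => |φ.derivative.derivative.eval x|)
    (φ.derivative.derivative.continuous.abs.continuousOn)
  exact ⟨_, abs_pos.2 (hφ x hx), fun y hy => hm hy⟩

/-- The mean value theorem for polynomials, on an unordered interval. -/
theorem exists_eval_sub_eval_eq (ψ : Polynomial ℝ) {x y : ℝ} :
    ∃ z ∈ Set.uIcc x y, ψ.eval x - ψ.eval y = ψ.derivative.eval z * (x - y) := by
  rcases lt_trichotomy x y with h | h | h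
  · obtain ⟨z, hz, h1⟩ := exists_hasDerivAt_eq_slope (fun t => ψ.eval t)
      (fun t => ψ.derivative.eval t) h ψ.continuous.continuousOn fun t _ => ψ.hasDerivAt t
    refine ⟨z, Set.Icc_subset_uIcc (Set.Ioo_subset_Icc_self hz), ?_⟩
    rw [h1]
    have : y - x ≠ 0 := by linarith
    field_simp
    ring
  · exact ⟨x, Set.left_mem_uIcc, by simp [h]⟩
  · obtain ⟨z, hz, h1⟩ := exists_hasDerivAt_eq_slope (fun t => ψ.eval t)
      (fun t => ψ.derivative.eval t) h ψ.continuous.continuousOn fun t _ => ψ.hasDerivAt t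
    refine ⟨z, Set.Icc_subset_uIcc' (Set.Ioo_subset_Icc_self hz), ?_⟩
    rw [h1]
    have : x - y ≠ 0 := by linarith
    field_simp

theorem uIcc_subset_Icc_neg_one_one {x y : ℝ} (hx : x ∈ Set.Icc (-1 : ℝ) 1)
    (hy : y ∈ Set.Icc (-1 : ℝ) 1) : Set.uIcc x y ⊆ Set.Icc (-1 : ℝ) 1 :=
  (Set.ordConnected_Icc).uIcc_subset hx hy

/-- Two applications of the mean value theorem: to t ↦ φ(t + s) - φ(t) between x and y, then to φ'
between the resulting point and its translate by s. -/
theorem le_abs_second_difference {φ : Polynomial ℝ} {c : ℝ}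
    (hc : ∀ x ∈ Set.Icc (-1 : ℝ) 1, c ≤ |φ.derivative.derivative.eval x|) {x y s : ℝ}
    (hx : x ∈ Set.Icc (-1 : ℝ) 1) (hy : y ∈ Set.Icc (-1 : ℝ) 1)
    (hxs : x + s ∈ Set.Icc (-1 : ℝ) 1) (hys : y + s ∈ Set.Icc (-1 : ℝ) 1) :
    c * |s| * |x - y| ≤ |(φ.eval (x + s) - φ.eval x) - (φ.eval (y + s) - φ.eval y)| := by
  set ψ : Polynomial ℝ := φ.comp (Polynomial.X + Polynomial.C s) - φ with hψ
  have he : ∀ t, ψ.eval t = φ.eval (t + s) - φ.eval t := fun t => by simp [hψ]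
  have hd : ∀ t, ψ.derivative.eval t = φ.derivative.eval (t + s) - φ.derivative.eval t :=
    fun t => by simp [hψ, Polynomial.derivative_comp]
  obtain ⟨z, hz, h1⟩ := exists_eval_sub_eval_eq ψ (x := x) (y := y)
  obtain ⟨w, hw, h2⟩ := exists_eval_sub_eval_eq φ.derivative (x := z + s) (y := z)
  have hz1 : z ∈ Set.Icc (-1 : ℝ) 1 := uIcc_subset_Icc_neg_one_one hx hy hz
  have hz2 : z + s ∈ Set.Icc (-1 : ℝ) 1 := by
    refine uIcc_subset_Icc_neg_one_one hxs hys ?_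
    rw [← Set.image_add_const_uIcc]
    exact ⟨z, hz, rfl⟩
  rw [← he, ← he, h1, hd, h2, abs_mul, abs_mul, add_sub_cancel_left]
  gcongr
  exact hc w (uIcc_subset_Icc_neg_one_one hz2 hz1 hw)

/-! ### Divisor counts and harmonic sums -/

theorem card_divisors_mul_le (a b : ℕ) :
    (a * b).divisors.card ≤ a.divisors.card * b.divisors.card := by
  open scoped Pointwise in
  rw [Nat.divisors_mul]
  exact Finset.card_mul_le

/-- The nonzero integers of absolute value at most `M`. -/
def nonzeroIcc (M : ℕ) : Finset ℤ := (Finset.Icc (-(M : ℤ)) M).erase 0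

theorem mem_nonzeroIcc {M : ℕ} {ℓ : ℤ} : ℓ ∈ nonzeroIcc M ↔ ℓ ≠ 0 ∧ |ℓ| ≤ M := by
  rw [nonzeroIcc, Finset.mem_erase, Finset.mem_Icc, abs_le]

theorem sum_nonzeroIcc_natAbs (M : ℕ) (f : ℕ → ℝ) :
    ∑ ℓ ∈ nonzeroIcc M, f ℓ.natAbs = 2 * ∑ i ∈ Finset.Icc 1 M, f i := by
  have hpos : (nonzeroIcc M).filter (fun ℓ => 0 < ℓ) =
      (Finset.Icc 1 M).map ⟨fun i : ℕ => (i : ℤ), Nat.cast_injective⟩ := by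
    ext ℓ
    simp only [Finset.mem_filter, mem_nonzeroIcc, Finset.mem_map, Finset.mem_Icc,
      Function.Embedding.coeFn_mk]
    constructor
    · rintro ⟨⟨h1, h2⟩, h3⟩
      exact ⟨ℓ.toNat, by rw [abs_le] at h2; omega, by omega⟩
    · rintro ⟨i, h1, rfl⟩
      rw [abs_le]
      omega
  have hneg : (nonzeroIcc M).filter (fun ℓ => ¬ 0 < ℓ) =
      (Finset.Icc 1 M).map (Nat.castEmbedding.trans (Equiv.neg ℤ).toEmbedding) := by
    ext ℓ
    simp only [Finset.mem_filter, mem_nonzeroIcc, Finset.mem_map, Finset.mem_Icc,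
      Function.Embedding.trans_apply, Nat.castEmbedding_apply, Equiv.coe_toEmbedding,
      Equiv.neg_apply]
    constructor
    · rintro ⟨⟨h1, h2⟩, h3⟩
      exact ⟨(-ℓ).toNat, by rw [abs_le] at h2; omega, by omega⟩
    · rintro ⟨i, h1, rfl⟩
      rw [abs_le]
      omega
  rw [← Finset.sum_filter_add_sum_filter_not _ (fun ℓ : ℤ => 0 < ℓ), hpos, hneg, Finset.sum_map,
    Finset.sum_map, two_mul]
  simp

/-- The first factor is, up to sign, a divisor of A, and it determines the second because A ≠ 0. -/
theorem card_filter_mul_eq_le (s : Finset (ℤ × ℤ)) {A : ℤ} (hA : A ≠ 0) :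
    (s.filter fun p => p.1 * p.2 = A).card ≤ 2 * A.natAbs.divisors.card := by
  set t : Finset ℤ := A.natAbs.divisors.image (fun i : ℕ => (i : ℤ)) ∪
    A.natAbs.divisors.image (fun i : ℕ => -(i : ℤ)) with ht
  have h1 : (s.filter fun p => p.1 * p.2 = A).card ≤ t.card := by
    refine Finset.card_le_card_of_injOn Prod.fst (fun p hp => ?_) fun p hp q hq h => ?_
    · have hp2 := (Finset.mem_filter.1 hp).2
      have hd : p.1.natAbs ∈ A.natAbs.divisors :=
        Nat.mem_divisors.2 ⟨Int.natAbs_dvd_natAbs.2 ⟨p.2, hp2.symm⟩, by simpa using hA⟩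
      rw [ht]
      simp only [Finset.coe_union, Finset.coe_image, Set.mem_union, Set.mem_image, Finset.mem_coe]
      rcases Int.natAbs_eq p.1 with h | h
      · exact Or.inl ⟨_, hd, h.symm⟩
      · exact Or.inr ⟨_, hd, h.symm⟩
    · have hp2 := (Finset.mem_filter.1 hp).2
      have hq2 := (Finset.mem_filter.1 hq).2
      have hp0 : p.1 ≠ 0 := fun h0 => hA (by rw [← hp2, h0, zero_mul])
      refine Prod.ext h (mul_left_cancel₀ hp0 ?_)
      rw [hp2, h, hq2]
  refine h1.trans ((Finset.card_union_le _ _).trans ?_)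
  rw [two_mul]
  exact add_le_add Finset.card_image_le Finset.card_image_le

theorem sum_one_div_nonneg (Q : ℕ) : (0 : ℝ) ≤ ∑ i ∈ Finset.Icc 1 Q, (1 : ℝ) / i :=
  Finset.sum_nonneg fun _ _ => by positivity

/-- Both sides sum w(ab) over the lattice points (a, b) under the hyperbola ab ≤ Q. -/
theorem sum_card_divisors_mul_le (Q : ℕ) (w : ℕ → ℝ) :
    ∑ i ∈ Finset.Icc 1 Q, (i.divisors.card : ℝ) * w i =
      ∑ a ∈ Finset.Icc 1 Q, ∑ b ∈ Finset.Icc 1 (Q / a), w (a * b) := by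
  have h1 : ∀ i ∈ Finset.Icc 1 Q, (i.divisors.card : ℝ) * w i =
      ∑ p ∈ i.divisorsAntidiagonal, w (p.1 * p.2) := by
    intro i _
    rw [Finset.sum_congr rfl (g := fun _ => w i), Finset.sum_const, nsmul_eq_mul,
      ← Nat.map_div_right_divisors, Finset.card_map]
    intro p hp
    rw [(Nat.mem_divisorsAntidiagonal.1 hp).1]
  rw [Finset.sum_congr rfl h1, Finset.sum_sigma', Finset.sum_sigma']
  refine (Finset.sum_bij' (fun x _ => ⟨x.2.1, x.2.2⟩)
    (fun y _ => ⟨y.1 * y.2, (y.1, y.2)⟩) ?_ ?_ ?_ ?_ ?_)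
  · rintro ⟨i, p⟩ h
    simp only [Finset.mem_sigma, Finset.mem_Icc, Nat.mem_divisorsAntidiagonal] at h ⊢
    obtain ⟨⟨h1, h2⟩, h3, h4⟩ := h
    have hp1 : 0 < p.1 := Nat.pos_of_ne_zero fun h0 => h4 (by rw [← h3, h0, zero_mul])
    have hp2 : 0 < p.2 := Nat.pos_of_ne_zero fun h0 => h4 (by rw [← h3, h0, mul_zero])
    refine ⟨⟨hp1, ?_⟩, hp2, ?_⟩
    · nlinarith
    · rw [Nat.le_div_iff_mul_le hp1, mul_comm, h3]
      exact h2
  · rintro ⟨a, b⟩ h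
    simp only [Finset.mem_sigma, Finset.mem_Icc, Nat.mem_divisorsAntidiagonal] at h ⊢
    obtain ⟨⟨h1, h2⟩, h3, h4⟩ := h
    rw [Nat.le_div_iff_mul_le h1, mul_comm] at h4
    exact ⟨⟨Nat.mul_pos h1 h3, h4⟩, trivial, (Nat.mul_pos h1 h3).ne'⟩
  · rintro ⟨i, p⟩ h
    simp only [Finset.mem_sigma, Nat.mem_divisorsAntidiagonal] at h
    obtain ⟨_, rfl, _⟩ := h
    rfl
  · rintro ⟨a, b⟩ _
    rfl
  · rintro ⟨i, p⟩ _
    rfl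

theorem sum_card_divisors_le (Q : ℕ) :
    ∑ i ∈ Finset.Icc 1 Q, (i.divisors.card : ℝ) ≤ Q * ∑ i ∈ Finset.Icc 1 Q, (1 : ℝ) / i := by
  have h := sum_card_divisors_mul_le Q fun _ => 1
  simp only [mul_one] at h
  rw [h, Finset.mul_sum]
  refine Finset.sum_le_sum fun a _ => ?_
  rw [Finset.sum_const, Nat.card_Icc, Nat.add_sub_cancel, nsmul_eq_mul, mul_one, mul_one_div]
  exact Nat.cast_div_le

theorem sum_card_divisors_div_le (Q : ℕ) :
    ∑ i ∈ Finset.Icc 1 Q, (i.divisors.card : ℝ) * (1 / (i : ℝ)) ≤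
      (∑ i ∈ Finset.Icc 1 Q, (1 : ℝ) / i) ^ 2 := by
  rw [sum_card_divisors_mul_le Q fun i => 1 / (i : ℝ), sq, Finset.sum_mul]
  refine Finset.sum_le_sum fun a _ => ?_
  rw [Finset.mul_sum]
  -- Enlarging the range b ≤ Q / a to b ≤ Q makes the double sum a square.
  refine (Finset.sum_le_sum_of_subset_of_nonneg
    (Finset.Icc_subset_Icc_right (Nat.div_le_self Q a)) fun _ _ _ => by positivity).trans
    (le_of_eq (Finset.sum_congr rfl fun b _ => ?_))
  push_cast
  rw [div_mul_div_comm, one_mul]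

theorem sum_offDiag_one_div_abs_le (n : ℕ) {K : Finset ℤ} (hK : K ⊆ allLevels n) :
    ∑ p ∈ K.offDiag, 1 / |((p.1 - p.2 : ℤ) : ℝ)| ≤
      K.card * (2 * ∑ i ∈ Finset.Icc 1 (2 * n), (1 : ℝ) / i) := by
  have h1 : ∀ p ∈ K.offDiag, (p.1, p.2 - p.1) ∈ K ×ˢ nonzeroIcc (2 * n) := by
    intro p hp
    obtain ⟨h1, h2, h3⟩ := Finset.mem_offDiag.1 hp
    have h4 := Finset.mem_Icc.1 (hK h1)
    have h5 := Finset.mem_Icc.1 (hK h2)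
    rw [Finset.mem_product, mem_nonzeroIcc, abs_le]
    refine ⟨h1, ?_⟩
    dsimp only
    push_cast
    omega
  have hinj : Set.InjOn (fun p : ℤ × ℤ => (p.1, p.2 - p.1)) (K.offDiag : Set (ℤ × ℤ)) := by
    intro p _ q _ h
    simp only [Prod.mk.injEq] at h
    exact Prod.ext h.1 (by omega)
  calc ∑ p ∈ K.offDiag, 1 / |((p.1 - p.2 : ℤ) : ℝ)|
      = ∑ q ∈ K.offDiag.image (fun p : ℤ × ℤ => (p.1, p.2 - p.1)), 1 / |(q.2 : ℝ)| := by
        rw [Finset.sum_image hinj]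
        refine Finset.sum_congr rfl fun p _ => ?_
        rw [← abs_neg]
        push_cast
        rw [neg_sub]
    _ ≤ ∑ q ∈ K ×ˢ nonzeroIcc (2 * n), 1 / |(q.2 : ℝ)| :=
        Finset.sum_le_sum_of_subset_of_nonneg (Finset.image_subset_iff.2 h1)
          fun _ _ _ => by positivity
    _ = _ := by
        rw [Finset.sum_product, ← sum_nonzeroIcc_natAbs (2 * n) fun i => (1 : ℝ) / i]
        simp only [Nat.cast_natAbs, Int.cast_abs]
        rw [Finset.sum_const, nsmul_eq_mul]

/-! ### Expansion of the fluctuation in level differences -/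

/-- The levels `k` for which both `k` and `k + h` belong to `K`. -/
def shiftedLevels (K : Finset ℤ) (h : ℤ) : Finset ℤ := K.filter fun k => k + h ∈ K

/-- The coefficient of `α` in the phase difference of the levels `k + h` and `k` of `U ^ ℓ`. -/
def phaseIncrement (φ : Polynomial ℝ) (n : ℕ) (ℓ h k : ℤ) : ℝ :=
  ℓ * n * (φ.eval (((k + h : ℤ) : ℝ) / n) - φ.eval ((k : ℝ) / n))

/-- The weighted sum of `|Tr U ^ ℓ|² - d` over `0 < |ℓ| ≤ M`. -/
def formFactorFluctuation (φ : Polynomial ℝ) (n : ℕ) (K : Finset ℤ) (M : ℕ) (F : ℤ → ℂ)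
    (p : ℝ × ℝ) : ℂ :=
  ∑ ℓ ∈ nonzeroIcc M, F ℓ * ((‖expSum φ p.1 p.2 n K ℓ‖ ^ 2 - K.card : ℝ) : ℂ)

theorem sum_offDiag_eq_sum_shiftedLevels {n : ℕ} {K : Finset ℤ} (hK : K ⊆ allLevels n)
    (f : ℤ → ℤ → ℂ) :
    ∑ p ∈ K.offDiag, f p.1 p.2 =
      ∑ h ∈ nonzeroIcc (2 * n), ∑ k ∈ shiftedLevels K h, f (k + h) k := by
  rw [Finset.sum_sigma']
  refine Finset.sum_bij' (fun p _ => ⟨p.1 - p.2, p.2⟩) (fun x _ => (x.2 + x.1, x.2)) ?_ ?_ ?_ ?_ ?_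
  · intro p hp
    obtain ⟨h1, h2, h3⟩ := Finset.mem_offDiag.1 hp
    have h4 := Finset.mem_Icc.1 (hK h1)
    have h5 := Finset.mem_Icc.1 (hK h2)
    rw [Finset.mem_sigma, mem_nonzeroIcc, shiftedLevels, Finset.mem_filter, abs_le]
    dsimp only
    refine ⟨?_, h2, by rwa [add_sub_cancel]⟩
    push_cast
    omega
  · rintro ⟨h, k⟩ hx
    rw [Finset.mem_sigma, mem_nonzeroIcc, shiftedLevels, Finset.mem_filter] at hx
    obtain ⟨⟨h1, _⟩, h2, h3⟩ := hx
    dsimp only at h1 h2 h3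
    exact Finset.mem_offDiag.2 ⟨h3, h2, by dsimp only; omega⟩
  · intro p _
    simp
  · rintro ⟨h, k⟩ _
    simp
  · intro p _
    simp

/-- The factor n cancels the denominator of k / n in the linear term, so β is paired with the
integer ℓh. This is what allows exact orthogonality in β. -/
theorem levelPhase_sub {n : ℕ} (hn : n ≠ 0) (φ : Polynomial ℝ) (α β : ℝ) (ℓ h k : ℤ) :
    ℓ * levelPhase φ α β n (k + h) - ℓ * levelPhase φ α β n k =
      α * phaseIncrement φ n ℓ h k + β * (ℓ * h : ℤ) := by
  have : (n : ℝ) ≠ 0 := by exact_mod_cast hn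
  rw [levelPhase, levelPhase, phaseIncrement]
  push_cast
  field_simp
  ring

theorem norm_expSum_sq_sub_card (φ : Polynomial ℝ) (α β : ℝ) {n : ℕ} (hn : n ≠ 0) {K : Finset ℤ}
    (hK : K ⊆ allLevels n) (ℓ : ℤ) :
    ((‖expSum φ α β n K ℓ‖ ^ 2 - K.card : ℝ) : ℂ) =
      ∑ h ∈ nonzeroIcc (2 * n), (∑ k ∈ shiftedLevels K h,
        Complex.exp (Complex.I * ((α * phaseIncrement φ n ℓ h k : ℝ) : ℂ))) *
          Complex.exp (Complex.I * ((β * (ℓ * h : ℤ) : ℝ) : ℂ)) := by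
  rw [Complex.ofReal_sub, expSum, norm_sum_sq_eq, ← Finset.sum_product' (f := fun i j =>
    Complex.exp (Complex.I * ((ℓ * levelPhase φ α β n i : ℝ) : ℂ)) *
    (starRingEnd ℂ) (Complex.exp (Complex.I * ((ℓ * levelPhase φ α β n j : ℝ) : ℂ)))),
    ← Finset.diag_union_offDiag, Finset.sum_union (Finset.disjoint_diag_offDiag K), Finset.sum_diag]
  simp_rw [exp_I_mul_mul_conj]
  rw [sum_offDiag_eq_sum_shiftedLevels hK fun i j => Complex.exp (Complex.I *
    ((ℓ * levelPhase φ α β n i - ℓ * levelPhase φ α β n j : ℝ) : ℂ))]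
  simp only [sub_self, Complex.ofReal_zero, mul_zero, Complex.exp_zero, Finset.sum_const,
    nsmul_eq_mul, mul_one, Complex.ofReal_natCast, add_sub_cancel_left]
  refine Finset.sum_congr rfl fun h _ => ?_
  rw [Finset.sum_mul]
  refine Finset.sum_congr rfl fun k _ => ?_
  rw [levelPhase_sub hn, ← Complex.exp_add, Complex.ofReal_add, mul_add]

theorem formFactorFluctuation_eq (φ : Polynomial ℝ) {n : ℕ} (hn : n ≠ 0) {K : Finset ℤ}
    (hK : K ⊆ allLevels n) (M : ℕ) (F : ℤ → ℂ) (α β : ℝ) :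
    formFactorFluctuation φ n K M F (α, β) =
      ∑ i ∈ nonzeroIcc M ×ˢ nonzeroIcc (2 * n),
        (F i.1 * ∑ k ∈ shiftedLevels K i.2,
          Complex.exp (Complex.I * ((α * phaseIncrement φ n i.1 i.2 k : ℝ) : ℂ))) *
            Complex.exp (Complex.I * ((β * (i.1 * i.2 : ℤ) : ℝ) : ℂ)) := by
  rw [formFactorFluctuation, Finset.sum_product]
  refine Finset.sum_congr rfl fun ℓ _ => ?_
  rw [norm_expSum_sq_sub_card φ α β hn hK, Finset.mul_sum]
  refine Finset.sum_congr rfl fun h _ => ?_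
  rw [mul_assoc]

/-! ### Second moment of the fluctuation -/

/-- Cauchy–Schwarz on each fibre of A, whose cardinality r controls. -/
theorem sum_image_norm_sum_sq_le {ι : Type*} (s : Finset ι) (A : ι → ℤ) (a : ι → ℂ) (r : ι → ℝ)
    (hr : ∀ i ∈ s, ((s.filter fun j => A j = A i).card : ℝ) ≤ r i) :
    ∑ B ∈ s.image A, ‖∑ i ∈ s with A i = B, a i‖ ^ 2 ≤ ∑ i ∈ s, r i * ‖a i‖ ^ 2 := by
  rw [← Finset.sum_fiberwise_of_maps_to (g := A) (t := s.image A)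
    (fun i hi => Finset.mem_image_of_mem A hi) fun i => r i * ‖a i‖ ^ 2]
  refine Finset.sum_le_sum fun B _ => ?_
  calc ‖∑ i ∈ s with A i = B, a i‖ ^ 2 ≤ (∑ i ∈ s with A i = B, ‖a i‖) ^ 2 := by
        gcongr
        exact norm_sum_le _ _
    _ ≤ (s.filter fun i => A i = B).card * ∑ i ∈ s with A i = B, ‖a i‖ ^ 2 :=
        sq_sum_le_card_mul_sum_sq
    _ ≤ _ := by
        rw [Finset.mul_sum]
        refine Finset.sum_le_sum fun i hi => ?_
        obtain ⟨his, rfl⟩ := Finset.mem_filter.1 hi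
        gcongr
        exact hr i his

/-- Parseval in β with frequencies ℓh; the multiplicity of a frequency is at most 2τ(|ℓh|) ≤
2τ(|ℓ|)τ(|h|), where τ counts divisors. -/
theorem integral_norm_formFactorFluctuation_sq_le (φ : Polynomial ℝ) {n : ℕ} (hn : n ≠ 0)
    {K : Finset ℤ} (hK : K ⊆ allLevels n) (M : ℕ) (F : ℤ → ℂ) {B : ℝ} (hF : ∀ ℓ, ‖F ℓ‖ ≤ B)
    (m : ℕ) (α : ℝ) :
    ∫ β in (-(Real.pi * m))..(Real.pi * m), ‖formFactorFluctuation φ n K M F (α, β)‖ ^ 2 ≤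
      4 * Real.pi * m * B ^ 2 * ∑ i ∈ nonzeroIcc M ×ˢ nonzeroIcc (2 * n),
        (i.1.natAbs.divisors.card * i.2.natAbs.divisors.card : ℝ) *
          ‖∑ k ∈ shiftedLevels K i.2,
            Complex.exp (Complex.I * ((α * phaseIncrement φ n i.1 i.2 k : ℝ) : ℂ))‖ ^ 2 := by
  simp_rw [formFactorFluctuation_eq φ hn hK]
  rw [integral_norm_sum_sq (nonzeroIcc M ×ˢ nonzeroIcc (2 * n)) fun i => i.1 * i.2]
  have h1 := sum_image_norm_sum_sq_le (nonzeroIcc M ×ˢ nonzeroIcc (2 * n))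
    (fun i => i.1 * i.2) (fun i => F i.1 * ∑ k ∈ shiftedLevels K i.2,
      Complex.exp (Complex.I * ((α * phaseIncrement φ n i.1 i.2 k : ℝ) : ℂ)))
    (fun i => 2 * (i.1.natAbs.divisors.card * i.2.natAbs.divisors.card)) ?_
  · calc _ ≤ 2 * Real.pi * m * _ := mul_le_mul_of_nonneg_left h1 (by positivity)
      _ ≤ 2 * Real.pi * m * ∑ i ∈ nonzeroIcc M ×ˢ nonzeroIcc (2 * n),
          2 * (i.1.natAbs.divisors.card * i.2.natAbs.divisors.card) * (B ^ 2 *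
          ‖∑ k ∈ shiftedLevels K i.2,
            Complex.exp (Complex.I * ((α * phaseIncrement φ n i.1 i.2 k : ℝ) : ℂ))‖ ^ 2) := by
          gcongr with i _
          rw [norm_mul, mul_pow]
          gcongr
          exact hF _
      _ = _ := by
          rw [Finset.mul_sum, Finset.mul_sum]
          refine Finset.sum_congr rfl fun i _ => ?_
          ring
  · intro i hi
    obtain ⟨h1, h2⟩ := Finset.mem_product.1 hi
    have h3 := card_filter_mul_eq_le (nonzeroIcc M ×ˢ nonzeroIcc (2 * n)) (A := i.1 * i.2)
      (mul_ne_zero (mem_nonzeroIcc.1 h1).1 (mem_nonzeroIcc.1 h2).1)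
    have h4 := card_divisors_mul_le i.1.natAbs i.2.natAbs
    rw [← Int.natAbs_mul] at h4
    exact_mod_cast h3.trans (Nat.mul_le_mul_left 2 h4)

theorem div_mem_Icc_of_mem_allLevels {n : ℕ} (hn : n ≠ 0) {k : ℤ} (hk : k ∈ allLevels n) :
    (k : ℝ) / n ∈ Set.Icc (-1 : ℝ) 1 := by
  have h0 : (0 : ℝ) < n := by exact_mod_cast Nat.pos_of_ne_zero hn
  obtain ⟨h1, h2⟩ := Finset.mem_Icc.1 hk
  have h1' : (-(n : ℝ)) ≤ k := by exact_mod_cast h1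
  have h2' : (k : ℝ) ≤ n := by exact_mod_cast h2
  rw [Set.mem_Icc, le_div_iff₀ h0, div_le_iff₀ h0]
  constructor <;> linarith

/-- The second-difference bound with step s = h / n: the two factors 1 / n, from s and from k / n -
k' / n, meet the factor n of the phase. -/
theorem le_abs_phaseIncrement_sub {φ : Polynomial ℝ} {c : ℝ}
    (hc : ∀ x ∈ Set.Icc (-1 : ℝ) 1, c ≤ |φ.derivative.derivative.eval x|) {n : ℕ} (hn : n ≠ 0)
    {K : Finset ℤ} (hK : K ⊆ allLevels n) (ℓ : ℤ) {h k k' : ℤ} (hk : k ∈ shiftedLevels K h)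
    (hk' : k' ∈ shiftedLevels K h) :
    c * (|(ℓ : ℝ)| * |(h : ℝ)|) * |((k - k' : ℤ) : ℝ)| / n ≤
      |phaseIncrement φ n ℓ h k - phaseIncrement φ n ℓ h k'| := by
  have h0 : (0 : ℝ) < n := by exact_mod_cast Nat.pos_of_ne_zero hn
  obtain ⟨h1, h2⟩ := Finset.mem_filter.1 hk
  obtain ⟨h3, h4⟩ := Finset.mem_filter.1 hk'
  have e : ∀ k : ℤ, ((k + h : ℤ) : ℝ) / n = (k : ℝ) / n + (h : ℝ) / n := fun k => by
    push_cast; rw [add_div]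
  have h5 := le_abs_second_difference hc (s := (h : ℝ) / n)
    (div_mem_Icc_of_mem_allLevels hn (hK h1)) (div_mem_Icc_of_mem_allLevels hn (hK h3))
    (by rw [← e]; exact div_mem_Icc_of_mem_allLevels hn (hK h2))
    (by rw [← e]; exact div_mem_Icc_of_mem_allLevels hn (hK h4))
  rw [phaseIncrement, phaseIncrement, e, e, ← mul_sub, abs_mul, abs_mul, Nat.abs_cast]
  calc c * (|(ℓ : ℝ)| * |(h : ℝ)|) * |((k - k' : ℤ) : ℝ)| / n
      = |(ℓ : ℝ)| * n * (c * |(h : ℝ) / n| * |(k : ℝ) / n - (k' : ℝ) / n|) := by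
        rw [← sub_div, abs_div, abs_div, Nat.abs_cast]
        push_cast
        field_simp
    _ ≤ _ := by gcongr

/-- The separation of the frequencies turns the off-diagonal sum into one over 1 / |k - k'|, which
costs only a harmonic sum per level. -/
theorem integral_norm_shiftedSum_sq_le {φ : Polynomial ℝ} {c : ℝ} (hc0 : 0 < c)
    (hc : ∀ x ∈ Set.Icc (-1 : ℝ) 1, c ≤ |φ.derivative.derivative.eval x|) {n : ℕ} (hn : n ≠ 0)
    {K : Finset ℤ} (hK : K ⊆ allLevels n) {ℓ h : ℤ} (hℓ : ℓ ≠ 0) (hh : h ≠ 0) (m : ℕ) :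
    ∫ α in (-(m : ℝ))..m, ‖∑ k ∈ shiftedLevels K h,
        Complex.exp (Complex.I * ((α * phaseIncrement φ n ℓ h k : ℝ) : ℂ))‖ ^ 2 ≤
      K.card * (2 * m + 4 * n / c * (∑ i ∈ Finset.Icc 1 (2 * n), (1 : ℝ) / i) *
        (1 / |(ℓ : ℝ)| * (1 / |(h : ℝ)|))) := by
  have h0 : (0 : ℝ) < n := by exact_mod_cast Nat.pos_of_ne_zero hn
  have hℓ' : (0 : ℝ) < |(ℓ : ℝ)| := by positivity
  have hh' : (0 : ℝ) < |(h : ℝ)| := by positivity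
  have hcard : ((shiftedLevels K h).card : ℝ) ≤ K.card := by
    exact_mod_cast Finset.card_filter_le _ _
  have hlow : ∀ k ∈ shiftedLevels K h, ∀ k' ∈ shiftedLevels K h, k ≠ k' →
      0 < c * (|(ℓ : ℝ)| * |(h : ℝ)|) * |((k - k' : ℤ) : ℝ)| / n := by
    intro k _ k' _ hkk
    have : 0 < |((k - k' : ℤ) : ℝ)| := abs_pos.2 (by exact_mod_cast sub_ne_zero.2 hkk)
    positivity
  have hinj : Set.InjOn (phaseIncrement φ n ℓ h) (shiftedLevels K h : Set ℤ) := by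
    intro k hk k' hk' he
    by_contra hkk
    have h1 := le_abs_phaseIncrement_sub hc hn hK ℓ hk hk'
    rw [he, sub_self, abs_zero] at h1
    exact absurd (hlow k hk k' hk' hkk) (not_lt.2 h1)
  refine (integral_norm_sum_exp_sq_le (shiftedLevels K h) (phaseIncrement φ n ℓ h) hinj
    m.cast_nonneg).trans ?_
  have hsum : ∑ p ∈ (shiftedLevels K h).offDiag,
      2 / |phaseIncrement φ n ℓ h p.1 - phaseIncrement φ n ℓ h p.2| ≤
      2 * n / (c * (|(ℓ : ℝ)| * |(h : ℝ)|)) *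
        ∑ p ∈ (shiftedLevels K h).offDiag, 1 / |((p.1 - p.2 : ℤ) : ℝ)| := by
    rw [Finset.mul_sum]
    refine Finset.sum_le_sum fun p hp => ?_
    obtain ⟨h1, h2, h3⟩ := Finset.mem_offDiag.1 hp
    refine (div_le_div_of_nonneg_left zero_le_two (hlow _ h1 _ h2 h3)
      (le_abs_phaseIncrement_sub hc hn hK ℓ h1 h2)).trans (le_of_eq ?_)
    have : |((p.1 - p.2 : ℤ) : ℝ)| ≠ 0 := abs_ne_zero.2 (by exact_mod_cast sub_ne_zero.2 h3)
    field_simp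
  have hsub : shiftedLevels K h ⊆ K := Finset.filter_subset _ _
  have hoff := sum_offDiag_one_div_abs_le n (hsub.trans hK)
  have hH := sum_one_div_nonneg (2 * n)
  calc _ ≤ 2 * (m : ℝ) * K.card + 2 * n / (c * (|(ℓ : ℝ)| * |(h : ℝ)|)) *
        (K.card * (2 * ∑ i ∈ Finset.Icc 1 (2 * n), (1 : ℝ) / i)) := by
        gcongr
        refine hsum.trans ?_
        gcongr
        refine hoff.trans ?_
        gcongr
    _ = _ := by
        field_simp
        ring

@[fun_prop]
theorem continuous_formFactorFluctuation (φ : Polynomial ℝ) (n : ℕ) (K : Finset ℤ) (M : ℕ)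
    (F : ℤ → ℂ) : Continuous (formFactorFluctuation φ n K M F) := by
  unfold formFactorFluctuation expSum levelPhase
  fun_prop

theorem lintegral_enorm_sq_prod_le {g : ℝ × ℝ → ℂ} (hg : Continuous g) {G : ℝ → ℝ}
    (hG : Continuous G) {a b : ℝ} (ha : 0 ≤ a) (hb : 0 ≤ b)
    (h : ∀ α, ∫ β in (-b)..b, ‖g (α, β)‖ ^ 2 ≤ G α) :
    ∫⁻ p in Set.Icc (-a) a ×ˢ Set.Icc (-b) b, ‖g p‖ₑ ^ 2 ≤
      ENNReal.ofReal (∫ α in (-a)..a, G α) := by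
  have e : ∀ p, ‖g p‖ₑ ^ 2 = ENNReal.ofReal (‖g p‖ ^ 2) := fun p => by
    rw [ENNReal.ofReal_pow (norm_nonneg _), ofReal_norm]
  have h0 : ∀ α, ∫⁻ β in Set.Icc (-b) b, ‖g (α, β)‖ₑ ^ 2 ≤ ENNReal.ofReal (G α) := by
    intro α
    simp_rw [e]
    rw [← ofReal_integral_eq_lintegral_ofReal, integral_Icc_eq_integral_Ioc,
      ← intervalIntegral.integral_of_le (by linarith)]
    · exact ENNReal.ofReal_le_ofReal (h α)
    · exact (by fun_prop : Continuous fun β => ‖g (α, β)‖ ^ 2).continuousOn.integrableOn_Icc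
    · exact ae_of_all _ fun _ => by positivity
  have hG0 : ∀ α, 0 ≤ G α := fun α => le_trans
    (intervalIntegral.integral_nonneg (by linarith) fun _ _ => by positivity) (h α)
  rw [Measure.volume_eq_prod, ← Measure.prod_restrict, lintegral_prod _ (by fun_prop)]
  calc _ ≤ ∫⁻ α in Set.Icc (-a) a, ENNReal.ofReal (G α) := lintegral_mono fun α => h0 α
    _ = _ := by
      rw [← ofReal_integral_eq_lintegral_ofReal, integral_Icc_eq_integral_Ioc,
        ← intervalIntegral.integral_of_le (by linarith)]
      · exact hG.continuousOn.integrableOn_Icc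
      · exact ae_of_all _ hG0

theorem sum_card_divisors_nonzeroIcc_le {M Q : ℕ} (hM : M ≤ Q) :
    ∑ ℓ ∈ nonzeroIcc M, (ℓ.natAbs.divisors.card : ℝ) ≤
      2 * (Q * ∑ i ∈ Finset.Icc 1 Q, (1 : ℝ) / i) := by
  rw [sum_nonzeroIcc_natAbs M fun i => (i.divisors.card : ℝ)]
  gcongr
  exact (Finset.sum_le_sum_of_subset_of_nonneg (Finset.Icc_subset_Icc_right hM)
    fun _ _ _ => by positivity).trans (sum_card_divisors_le Q)

theorem sum_card_divisors_div_nonzeroIcc_le {M Q : ℕ} (hM : M ≤ Q) :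
    ∑ ℓ ∈ nonzeroIcc M, (ℓ.natAbs.divisors.card : ℝ) * (1 / |(ℓ : ℝ)|) ≤
      2 * (∑ i ∈ Finset.Icc 1 Q, (1 : ℝ) / i) ^ 2 := by
  have := sum_nonzeroIcc_natAbs M fun i => (i.divisors.card : ℝ) * (1 / (i : ℝ))
  simp only [Nat.cast_natAbs, Int.cast_abs] at this
  rw [this]
  gcongr
  exact (Finset.sum_le_sum_of_subset_of_nonneg (Finset.Icc_subset_Icc_right hM)
    fun _ _ _ => by positivity).trans (sum_card_divisors_div_le Q)

/-- With H the harmonic sum, the weighted sum over (ℓ, h) factorizes. The diagonal part gives (QH)²,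
and the off-diagonal part gives H from the sum over k and H² from each of ℓ and h. -/
theorem lintegral_formFactorFluctuation_le {φ : Polynomial ℝ} {c : ℝ} (hc0 : 0 < c)
    (hc : ∀ x ∈ Set.Icc (-1 : ℝ) 1, c ≤ |φ.derivative.derivative.eval x|) {n : ℕ} (hn : n ≠ 0)
    {K : Finset ℤ} (hK : K ⊆ allLevels n) {M Q : ℕ} (hM : M ≤ Q) (hQ : 2 * n ≤ Q) (F : ℤ → ℂ)
    {B : ℝ} (hF : ∀ ℓ, ‖F ℓ‖ ≤ B) (m : ℕ) :
    ∫⁻ p in Set.Icc (-(m : ℝ)) m ×ˢ Set.Icc (-(Real.pi * m)) (Real.pi * m),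
        ‖formFactorFluctuation φ n K M F p‖ₑ ^ 2 ≤
      ENNReal.ofReal (4 * Real.pi * m * B ^ 2 * (K.card *
        (8 * m * (Q * ∑ i ∈ Finset.Icc 1 Q, (1 : ℝ) / i) ^ 2 +
          16 * n / c * (∑ i ∈ Finset.Icc 1 Q, (1 : ℝ) / i) ^ 5))) := by
  refine (lintegral_enorm_sq_prod_le (by fun_prop) (by fun_prop) m.cast_nonneg (by positivity)
    (integral_norm_formFactorFluctuation_sq_le φ hn hK M F hF m)).trans
    (ENNReal.ofReal_le_ofReal ?_)
  rw [intervalIntegral.integral_const_mul, intervalIntegral.integral_finsetSum]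
  swap
  · intro i _
    apply Continuous.intervalIntegrable
    fun_prop
  set H := ∑ i ∈ Finset.Icc 1 Q, (1 : ℝ) / i with hHdef
  have hH : 0 ≤ H := sum_one_div_nonneg Q
  have hHn : ∑ i ∈ Finset.Icc 1 (2 * n), (1 : ℝ) / i ≤ H :=
    Finset.sum_le_sum_of_subset_of_nonneg (Finset.Icc_subset_Icc_right hQ)
      fun _ _ _ => by positivity
  have hHn0 := sum_one_div_nonneg (2 * n)
  have h1 := sum_card_divisors_nonzeroIcc_le hM
  have h2 := sum_card_divisors_nonzeroIcc_le hQ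
  have h3 := sum_card_divisors_div_nonzeroIcc_le hM
  have h4 := sum_card_divisors_div_nonzeroIcc_le hQ
  rw [← hHdef] at h1 h2 h3 h4
  clear_value H
  gcongr 4 * Real.pi * m * B ^ 2 * ?_
  calc _ ≤ ∑ i ∈ nonzeroIcc M ×ˢ nonzeroIcc (2 * n),
        (i.1.natAbs.divisors.card * i.2.natAbs.divisors.card : ℝ) *
          (K.card * (2 * m + 4 * n / c * H * (1 / |(i.1 : ℝ)| * (1 / |(i.2 : ℝ)|)))) := by
        refine Finset.sum_le_sum fun i hi => ?_
        obtain ⟨hi1, hi2⟩ := Finset.mem_product.1 hi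
        rw [intervalIntegral.integral_const_mul]
        gcongr
        refine (integral_norm_shiftedSum_sq_le hc0 hc hn hK (mem_nonzeroIcc.1 hi1).1
          (mem_nonzeroIcc.1 hi2).1 m).trans ?_
        gcongr
    _ = K.card * (2 * m * ((∑ ℓ ∈ nonzeroIcc M, (ℓ.natAbs.divisors.card : ℝ)) *
          ∑ h ∈ nonzeroIcc (2 * n), (h.natAbs.divisors.card : ℝ)) +
        4 * n / c * H * ((∑ ℓ ∈ nonzeroIcc M, (ℓ.natAbs.divisors.card : ℝ) * (1 / |(ℓ : ℝ)|)) *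
          ∑ h ∈ nonzeroIcc (2 * n), (h.natAbs.divisors.card : ℝ) * (1 / |(h : ℝ)|))) := by
        rw [Finset.sum_mul_sum, Finset.sum_mul_sum, ← Finset.sum_product', ← Finset.sum_product',
          Finset.mul_sum, Finset.mul_sum, ← Finset.sum_add_distrib, Finset.mul_sum]
        refine Finset.sum_congr rfl fun i _ => ?_
        ring
    _ ≤ K.card * (2 * m * ((2 * (Q * H)) * (2 * (Q * H))) +
        4 * n / c * H * ((2 * H ^ 2) * (2 * H ^ 2))) := by
        have h5 := mul_le_mul h1 h2 (Finset.sum_nonneg fun _ _ => by positivity) (by positivity)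
        have h6 := mul_le_mul h3 h4 (Finset.sum_nonneg fun _ _ => by positivity) (by positivity)
        gcongr
    _ = _ := by ring

theorem sum_one_div_le_rpow (Q : ℕ) (hQ : 1 ≤ Q) :
    ∑ i ∈ Finset.Icc 1 Q, (1 : ℝ) / i ≤ 11 * (Q : ℝ) ^ (1 / 10 : ℝ) := by
  have h1 := harmonic_le_one_add_log Q
  have h2 : ((harmonic Q : ℚ) : ℝ) = ∑ i ∈ Finset.Icc 1 Q, (1 : ℝ) / i := by
    rw [harmonic_eq_sum_Icc]
    push_cast
    simp only [one_div]
  rw [← h2]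
  -- The exponent 1/10 is chosen so that the fifth power of the harmonic sum costs n^(1/2); log Q ≤
  -- 10 Q^(1/10), and the extra 1 makes the constant 11.
  have h3 := Real.log_le_rpow_div (Nat.cast_nonneg Q) (show (0 : ℝ) < 1 / 10 by norm_num)
  have h4 : (1 : ℝ) ≤ (Q : ℝ) ^ (1 / 10 : ℝ) :=
    Real.one_le_rpow (by exact_mod_cast hQ) (by norm_num)
  linarith

theorem card_le_three_mul {n : ℕ} (hn : 1 ≤ n) {K : Finset ℤ} (hK : K ⊆ allLevels n) :
    K.card ≤ 3 * n := by
  have h1 := Finset.card_le_card hK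
  rw [allLevels, Int.card_Icc] at h1
  omega

theorem exists_lintegral_formFactorFluctuation_le {φ : Polynomial ℝ}
    (hφ : ∀ x ∈ Set.Icc (-1 : ℝ) 1, φ.derivative.derivative.eval x ≠ 0) (C m : ℕ) (B : ℝ) :
    ∃ D : ℝ, 0 ≤ D ∧ ∀ n : ℕ, n ≠ 0 → ∀ K : Finset ℤ, K ⊆ allLevels n → ∀ F : ℤ → ℂ,
      (∀ ℓ, ‖F ℓ‖ ≤ B) → ∫⁻ p in Set.Icc (-(m : ℝ)) m ×ˢ Set.Icc (-(Real.pi * m)) (Real.pi * m),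
        ‖formFactorFluctuation φ n K (C * n) F p‖ₑ ^ 2 ≤
          ENNReal.ofReal (D * (n : ℝ) ^ (7 / 2 : ℝ)) := by
  obtain ⟨c, hc0, hc⟩ := exists_le_abs_derivative_derivative hφ
  -- With this q, the cutoff qn dominates both the range Cn of ℓ and the range 2n of h.
  set q : ℕ := C + 2 with hq
  set E : ℝ := 11 * (q : ℝ) ^ (1 / 10 : ℝ) with hE
  have hE0 : 0 ≤ E := by positivity
  refine ⟨4 * Real.pi * m * B ^ 2 * (3 * (8 * m * (q * E) ^ 2 + 16 / c * E ^ 5)),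
    by positivity, fun n hn K hK F hF => ?_⟩
  have hn1 : 1 ≤ n := Nat.one_le_iff_ne_zero.2 hn
  have hn1' : (1 : ℝ) ≤ n := by exact_mod_cast hn1
  have hn0 : (0 : ℝ) < n := by linarith
  refine (lintegral_formFactorFluctuation_le hc0 hc hn hK (M := C * n) (Q := q * n)
    (by rw [hq]; nlinarith) (by rw [hq]; nlinarith) F hF m).trans (ENNReal.ofReal_le_ofReal ?_)
  have hH0 := sum_one_div_nonneg (q * n)
  have hH : ∑ i ∈ Finset.Icc 1 (q * n), (1 : ℝ) / i ≤ E * (n : ℝ) ^ (1 / 10 : ℝ) := by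
    refine (sum_one_div_le_rpow (q * n) (by rw [hq]; nlinarith)).trans (le_of_eq ?_)
    rw [Nat.cast_mul, Real.mul_rpow (by positivity) (by positivity), hE, mul_assoc]
  set H := ∑ i ∈ Finset.Icc 1 (q * n), (1 : ℝ) / i
  have hcard : (K.card : ℝ) ≤ 3 * n := by exact_mod_cast card_le_three_mul hn1 hK
  have hx : ((n : ℝ) ^ (1 / 10 : ℝ)) ^ 5 = (n : ℝ) ^ (1 / 2 : ℝ) := by
    rw [← Real.rpow_mul_natCast hn0.le]; norm_num
  have hx2 : ((n : ℝ) ^ (1 / 10 : ℝ)) ^ 2 ≤ (n : ℝ) ^ (1 / 2 : ℝ) := by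
    rw [← Real.rpow_mul_natCast hn0.le]
    exact Real.rpow_le_rpow_of_exponent_le hn1' (by norm_num)
  have hx3 : (n : ℝ) ^ (7 / 2 : ℝ) = n ^ 3 * (n : ℝ) ^ (1 / 2 : ℝ) := by
    rw [← Real.rpow_natCast, ← Real.rpow_add hn0]; norm_num
  set x := (n : ℝ) ^ (1 / 10 : ℝ)
  set y := (n : ℝ) ^ (1 / 2 : ℝ)
  have hx0 : 0 ≤ x := by positivity
  have hy0 : 0 ≤ y := by positivity
  rw [hx3]
  calc _ ≤ 4 * Real.pi * m * B ^ 2 * ((3 * n) *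
        (8 * m * ((q * n) * (E * x)) ^ 2 + 16 * n / c * (E * x) ^ 5)) := by
        push_cast
        gcongr
    _ = 4 * Real.pi * m * B ^ 2 * (3 * (8 * m * (q * E) ^ 2 * (n ^ 3 * x ^ 2) +
          16 / c * E ^ 5 * (n ^ 2 * x ^ 5))) := by ring
    _ ≤ 4 * Real.pi * m * B ^ 2 * (3 * (8 * m * (q * E) ^ 2 * (n ^ 3 * y) +
          16 / c * E ^ 5 * (n ^ 3 * y))) := by
        rw [hx]
        gcongr
        norm_num
    _ = _ := by ring

/-! ### From second moments to averages almost everywhere -/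

/-- Kronecker's lemma for nonnegative terms. -/
theorem tendsto_average_of_summable_div {y : ℕ → ℝ} (hy : ∀ n, 0 ≤ y n)
    (hs : Summable fun n => y n / n) :
    Tendsto (fun N : ℕ => (1 / (N : ℝ)) * ∑ n ∈ Finset.Icc 1 N, y n) atTop (𝓝 0) := by
  -- Dominated convergence for series: y n / N tends to 0 for fixed n, and it is at most y n / n as
  -- long as n ≤ N.
  have h1 := tendsto_tsum_of_dominated_convergence (𝓕 := atTop)
    (f := fun (N : ℕ) (n : ℕ) => if n ∈ Finset.Icc 1 N then 1 / (N : ℝ) * y n else 0)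
    (g := fun _ => 0) (bound := fun n => y n / n) hs ?_ ?_
  · rw [tsum_zero] at h1
    refine h1.congr fun N => ?_
    rw [tsum_eq_sum (s := Finset.Icc 1 N) fun n hn => if_neg hn, Finset.mul_sum]
    exact Finset.sum_congr rfl fun n hn => if_pos hn
  · intro n
    have h2 : Tendsto (fun N : ℕ => 1 / (N : ℝ) * y n) atTop (𝓝 0) := by
      simpa using tendsto_one_div_atTop_nhds_zero_nat.mul_const (y n)
    refine squeeze_zero (fun N => ?_) (fun N => ?_) h2
    · split_ifs
      · exact mul_nonneg (by positivity) (hy n)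
      · rfl
    · split_ifs
      · rfl
      · exact mul_nonneg (by positivity) (hy n)
  · refine Eventually.of_forall fun N n => ?_
    split_ifs with h
    · obtain ⟨h1, h2⟩ := Finset.mem_Icc.1 h
      have h1' : (0 : ℝ) < n := by exact_mod_cast h1
      have h2' : (n : ℝ) ≤ N := by exact_mod_cast h2
      rw [Real.norm_of_nonneg (mul_nonneg (by positivity) (hy n)), one_div_mul_eq_div]
      exact div_le_div_of_nonneg_left (hy n) h1' h2'
    · rw [norm_zero]
      exact div_nonneg (hy n) n.cast_nonneg

theorem tendsto_average_of_summable_sq_div {y : ℕ → ℝ} (hy : ∀ n, 0 ≤ y n)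
    (hs : Summable fun n => y n ^ 2 / n) :
    Tendsto (fun N : ℕ => (1 / (N : ℝ)) * ∑ n ∈ Finset.Icc 1 N, y n) atTop (𝓝 0) := by
  have h1 := (tendsto_average_of_summable_div (fun n => sq_nonneg (y n)) hs).sqrt
  rw [Real.sqrt_zero] at h1
  refine squeeze_zero (fun N => mul_nonneg (by positivity) (Finset.sum_nonneg fun n _ => hy n))
    (fun N => Real.le_sqrt_of_sq_le ?_) h1
  have h2 := sq_sum_le_card_mul_sum_sq (s := Finset.Icc 1 N) (f := y)
  rw [Nat.card_Icc, Nat.add_sub_cancel] at h2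
  rcases Nat.eq_zero_or_pos N with rfl | hN
  · simp
  have hN' : (0 : ℝ) < N := by exact_mod_cast hN
  calc _ = (1 / (N : ℝ)) ^ 2 * (∑ n ∈ Finset.Icc 1 N, y n) ^ 2 := by rw [mul_pow]
    _ ≤ (1 / (N : ℝ)) ^ 2 * (N * ∑ n ∈ Finset.Icc 1 N, y n ^ 2) := by gcongr
    _ = _ := by field_simp

theorem ae_of_forall_ae_restrict_box {P : ℝ × ℝ → Prop}
    (h : ∀ m : ℕ, ∀ᵐ p ∂(volume.restrict
      (Set.Icc (-(m : ℝ)) m ×ˢ Set.Icc (-(Real.pi * m)) (Real.pi * m))), P p) :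
    ∀ᵐ p : ℝ × ℝ, P p := by
  have hU : (⋃ m : ℕ, Set.Icc (-(m : ℝ)) m ×ˢ Set.Icc (-(Real.pi * m)) (Real.pi * m)) =
      (Set.univ : Set (ℝ × ℝ)) := by
    refine Set.eq_univ_of_forall fun p => Set.mem_iUnion.2 ?_
    obtain ⟨m, hm⟩ := exists_nat_ge (max |p.1| |p.2|)
    have h1 := (le_max_left _ _).trans hm
    have h2 := (le_max_right _ _).trans hm
    have h3 : (m : ℝ) ≤ Real.pi * m :=
      le_mul_of_one_le_left m.cast_nonneg (by linarith [Real.pi_gt_three])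
    exact ⟨m, Set.mk_mem_prod (abs_le.1 h1) (abs_le.1 (h2.trans h3))⟩
  rw [← Measure.restrict_univ (μ := (volume : Measure (ℝ × ℝ))), ← hU, ae_restrict_iUnion_iff]
  exact h

theorem ae_tendsto_average_norm_div_sq {g : ℕ → ℝ × ℝ → ℂ} (hg : ∀ n, Continuous (g n))
    (hD : ∀ m : ℕ, ∃ D : ℝ, 0 ≤ D ∧ ∀ n : ℕ, n ≠ 0 →
      ∫⁻ p in Set.Icc (-(m : ℝ)) m ×ˢ Set.Icc (-(Real.pi * m)) (Real.pi * m), ‖g n p‖ₑ ^ 2 ≤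
        ENNReal.ofReal (D * (n : ℝ) ^ (7 / 2 : ℝ))) :
    ∀ᵐ p : ℝ × ℝ, Tendsto (fun N : ℕ => (1 / (N : ℝ)) * ∑ n ∈ Finset.Icc 1 N,
      ‖g n p‖ / (n : ℝ) ^ 2) atTop (𝓝 0) := by
  refine ae_of_forall_ae_restrict_box fun m => ?_
  obtain ⟨D, hD0, hD⟩ := hD m
  set μ := (volume : Measure (ℝ × ℝ)).restrict
    (Set.Icc (-(m : ℝ)) m ×ˢ Set.Icc (-(Real.pi * m)) (Real.pi * m)) with hμ
  -- The power 5 is 4 from the square of the normalization n² plus 1 from Kronecker's lemma; against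
  -- n^(7/2) it leaves the summable n^(-3/2).
  set w : ℕ → ENNReal := fun n => ENNReal.ofReal (1 / (n : ℝ) ^ 5) with hw
  have hfin : ∫⁻ p, ∑' n : ℕ, w n * ‖g n p‖ₑ ^ 2 ∂μ ≠ ⊤ := by
    rw [lintegral_tsum fun n => by fun_prop]
    have hle : ∀ n : ℕ, ∫⁻ p, w n * ‖g n p‖ₑ ^ 2 ∂μ ≤
        ENNReal.ofReal (D * (1 / (n : ℝ) ^ (3 / 2 : ℝ))) := by
      intro n
      rw [lintegral_const_mul' _ _ ENNReal.ofReal_ne_top]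
      rcases Nat.eq_zero_or_pos n with rfl | hn
      · simp
      · refine (mul_le_mul_right (hD n hn.ne') (w n)).trans (le_of_eq ?_)
        have hn0 : (0 : ℝ) < n := by exact_mod_cast hn
        rw [hw, ← ENNReal.ofReal_mul (by positivity)]
        congr 1
        rw [one_div, one_div, ← Real.rpow_natCast, ← Real.rpow_neg hn0.le, ← Real.rpow_neg hn0.le,
          mul_left_comm, ← Real.rpow_add hn0]
        norm_num
    refine ne_top_of_le_ne_top ?_ (ENNReal.tsum_le_tsum hle)
    have hs : Summable fun n : ℕ => D * (1 / (n : ℝ) ^ (3 / 2 : ℝ)) :=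
      (Real.summable_one_div_nat_rpow.2 (by norm_num)).mul_left D
    exact hs.tsum_ofReal_ne_top
  have hae := ae_lt_top' (by fun_prop) hfin
  filter_upwards [hae] with p hp
  refine tendsto_average_of_summable_sq_div (fun n => by positivity) ?_
  have h1 := ENNReal.summable_toReal hp.ne
  refine h1.congr fun n => ?_
  rw [ENNReal.toReal_mul, ENNReal.toReal_pow, toReal_enorm, hw,
    ENNReal.toReal_ofReal (by positivity), div_pow, div_div, one_div_mul_eq_div]
  congr 1
  ring

/-! ### One null set for all weights -/

/-- The weights `u(ℓ / d)` of a function `u` on `[-C, C]`. -/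
def gridWeight {C : ℕ} (u : C(Set.Icc (-(C : ℝ)) C, ℂ)) (d : ℕ) (ℓ : ℤ) : ℂ :=
  u (Set.projIcc (-(C : ℝ)) C (by linarith [(Nat.cast_nonneg C : (0 : ℝ) ≤ C)]) ((ℓ : ℝ) / d))

theorem norm_gridWeight_le {C : ℕ} (u : C(Set.Icc (-(C : ℝ)) C, ℂ)) (d : ℕ) (ℓ : ℤ) :
    ‖gridWeight u d ℓ‖ ≤ ‖u‖ := u.norm_coe_le_norm _

/-- Stability in the weight. Since T = |Tr U^ℓ|² ≥ 0, one has |T - d| ≤ (T - d) + 2d, so the sum of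
absolute values is controlled by the fluctuation with constant weight 1. -/
theorem norm_formFactorFluctuation_sub_le (φ : Polynomial ℝ) (n : ℕ) (K : Finset ℤ) {C : ℕ}
    (u v : C(Set.Icc (-(C : ℝ)) C, ℂ)) (p : ℝ × ℝ) :
    ‖formFactorFluctuation φ n K (C * n) (gridWeight u K.card) p‖ ≤
      ‖formFactorFluctuation φ n K (C * n) (gridWeight v K.card) p‖ +
      ‖u - v‖ * (‖formFactorFluctuation φ n K (C * n) (gridWeight (C := C) 1 K.card) p‖ +
        4 * C * n * K.card) := by
  have h1 : formFactorFluctuation φ n K (C * n) (gridWeight u K.card) p -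
      formFactorFluctuation φ n K (C * n) (gridWeight v K.card) p =
      ∑ ℓ ∈ nonzeroIcc (C * n), gridWeight (u - v) K.card ℓ *
        ((‖expSum φ p.1 p.2 n K ℓ‖ ^ 2 - K.card : ℝ) : ℂ) := by
    rw [formFactorFluctuation, formFactorFluctuation, ← Finset.sum_sub_distrib]
    refine Finset.sum_congr rfl fun ℓ _ => ?_
    rw [← sub_mul]
    rfl
  have hcard : ∑ ℓ ∈ nonzeroIcc (C * n), (1 : ℝ) = 2 * (C * n) := by
    rw [sum_nonzeroIcc_natAbs (C * n) fun _ => 1]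
    simp
  have h2 : ∑ ℓ ∈ nonzeroIcc (C * n), |‖expSum φ p.1 p.2 n K ℓ‖ ^ 2 - K.card| ≤
      ‖formFactorFluctuation φ n K (C * n) (gridWeight (C := C) 1 K.card) p‖ +
        4 * C * n * K.card := by
    have h3 : formFactorFluctuation φ n K (C * n) (gridWeight (C := C) 1 K.card) p =
        ((∑ ℓ ∈ nonzeroIcc (C * n), (‖expSum φ p.1 p.2 n K ℓ‖ ^ 2 - K.card) : ℝ) : ℂ) := by
      rw [formFactorFluctuation, Complex.ofReal_sum]
      refine Finset.sum_congr rfl fun ℓ _ => ?_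
      rw [gridWeight, ContinuousMap.one_apply, one_mul]
    calc _ ≤ ∑ ℓ ∈ nonzeroIcc (C * n), ((‖expSum φ p.1 p.2 n K ℓ‖ ^ 2 - K.card) +
          2 * K.card * 1) := by
          refine Finset.sum_le_sum fun ℓ _ => abs_le.2 ?_
          have hK : (0 : ℝ) ≤ K.card := Nat.cast_nonneg _
          have hT : 0 ≤ ‖expSum φ p.1 p.2 n K ℓ‖ ^ 2 := by positivity
          constructor <;> linarith
      _ = ∑ ℓ ∈ nonzeroIcc (C * n), (‖expSum φ p.1 p.2 n K ℓ‖ ^ 2 - K.card) +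
          4 * C * n * K.card := by
          rw [Finset.sum_add_distrib, ← Finset.mul_sum, hcard]
          ring
      _ ≤ _ := by
          gcongr
          rw [h3, Complex.norm_real]
          exact le_abs_self _
  have h4 : ‖formFactorFluctuation φ n K (C * n) (gridWeight u K.card) p -
      formFactorFluctuation φ n K (C * n) (gridWeight v K.card) p‖ ≤ ‖u - v‖ *
      ∑ ℓ ∈ nonzeroIcc (C * n), |‖expSum φ p.1 p.2 n K ℓ‖ ^ 2 - K.card| := by
    rw [h1, Finset.mul_sum]
    refine (norm_sum_le _ _).trans (Finset.sum_le_sum fun ℓ _ => ?_)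
    rw [norm_mul, Complex.norm_real, Real.norm_eq_abs]
    gcongr
    exact norm_gridWeight_le _ _ _
  have h5 := norm_sub_norm_le (formFactorFluctuation φ n K (C * n) (gridWeight u K.card) p)
    (formFactorFluctuation φ n K (C * n) (gridWeight v K.card) p)
  have h6 := mul_le_mul_of_nonneg_left h2 (norm_nonneg (u - v))
  linarith

/-- The fluctuations of the form factor vanish on average, for all weights. -/
def FluctuationsVanish (φ : Polynomial ℝ) (K : ℕ → Finset ℤ) (p : ℝ × ℝ) : Prop :=
  ∀ (C : ℕ) (u : C(Set.Icc (-(C : ℝ)) C, ℂ)),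
    Tendsto (fun N : ℕ => (1 / (N : ℝ)) * ∑ n ∈ Finset.Icc 1 N,
      ‖formFactorFluctuation φ n (K n) (C * n) (gridWeight u (K n).card) p‖ / (n : ℝ) ^ 2)
      atTop (𝓝 0)

theorem ae_fluctuationsVanish {φ : Polynomial ℝ}
    (hφ : ∀ x ∈ Set.Icc (-1 : ℝ) 1, φ.derivative.derivative.eval x ≠ 0) {K : ℕ → Finset ℤ}
    (hK : ∀ n, K n ⊆ allLevels n) : ∀ᵐ p : ℝ × ℝ, FluctuationsVanish φ K p := by
  have h1 : ∀ (C : ℕ) (u : C(Set.Icc (-(C : ℝ)) C, ℂ)), ∀ᵐ p : ℝ × ℝ,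
      Tendsto (fun N : ℕ => (1 / (N : ℝ)) * ∑ n ∈ Finset.Icc 1 N,
        ‖formFactorFluctuation φ n (K n) (C * n) (gridWeight u (K n).card) p‖ / (n : ℝ) ^ 2)
        atTop (𝓝 0) := by
    intro C u
    refine ae_tendsto_average_norm_div_sq (fun n => by fun_prop) fun m => ?_
    obtain ⟨D, hD0, hD⟩ := exists_lintegral_formFactorFluctuation_le hφ C m ‖u‖
    exact ⟨D, hD0, fun n hn => hD n hn (K n) (hK n) _ (norm_gridWeight_le u _)⟩
  have h2 : ∀ᵐ p : ℝ × ℝ, ∀ (C i : ℕ), Tendsto (fun N : ℕ => (1 / (N : ℝ)) *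
      ∑ n ∈ Finset.Icc 1 N, ‖formFactorFluctuation φ n (K n) (C * n)
        (gridWeight (TopologicalSpace.denseSeq C(Set.Icc (-(C : ℝ)) C, ℂ) i) (K n).card) p‖ /
        (n : ℝ) ^ 2) atTop (𝓝 0) :=
    ae_all_iff.2 fun C => ae_all_iff.2 fun i => h1 C _
  have h3 : ∀ᵐ p : ℝ × ℝ, ∀ C : ℕ, Tendsto (fun N : ℕ => (1 / (N : ℝ)) *
      ∑ n ∈ Finset.Icc 1 N, ‖formFactorFluctuation φ n (K n) (C * n)
        (gridWeight (C := C) 1 (K n).card) p‖ / (n : ℝ) ^ 2) atTop (𝓝 0) :=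
    ae_all_iff.2 fun C => h1 C 1
  filter_upwards [h2, h3] with p hp2 hp3 C u
  rw [Metric.tendsto_atTop]
  intro ε hε
  -- The 1 will bound the average for the constant weight; 12C is 4Cnd / n² with d ≤ 3n.
  obtain ⟨δ, hδ0, hδ⟩ : ∃ δ : ℝ, 0 < δ ∧ δ * (1 + 12 * C) ≤ ε / 2 :=
    ⟨ε / 2 / (1 + 12 * C), by positivity, by rw [div_mul_cancel₀ _ (by positivity)]⟩
  obtain ⟨i, hi⟩ := (TopologicalSpace.denseRange_denseSeq
    C(Set.Icc (-(C : ℝ)) C, ℂ)).exists_dist_lt u hδ0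
  set v := TopologicalSpace.denseSeq C(Set.Icc (-(C : ℝ)) C, ℂ) i
  rw [dist_eq_norm] at hi
  have e1 := (hp2 C i).eventually (gt_mem_nhds (half_pos hε))
  have e2 := (hp3 C).eventually (gt_mem_nhds one_pos)
  obtain ⟨N₀, hN₀⟩ := eventually_atTop.1 (e1.and (e2.and (eventually_ge_atTop 1)))
  refine ⟨N₀, fun N hN => ?_⟩
  obtain ⟨h4, h5, h6⟩ := hN₀ N hN
  have hN0 : (0 : ℝ) < N := by exact_mod_cast h6
  rw [Real.dist_0_eq_abs, abs_of_nonneg (by positivity)]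
  have hterm : ∀ n ∈ Finset.Icc 1 N,
      ‖formFactorFluctuation φ n (K n) (C * n) (gridWeight u (K n).card) p‖ / (n : ℝ) ^ 2 ≤
      ‖formFactorFluctuation φ n (K n) (C * n) (gridWeight v (K n).card) p‖ / (n : ℝ) ^ 2 +
      δ * (‖formFactorFluctuation φ n (K n) (C * n) (gridWeight (C := C) 1 (K n).card) p‖ /
        (n : ℝ) ^ 2 + 12 * C) := by
    intro n hn
    have hn1 := (Finset.mem_Icc.1 hn).1
    have hn0 : (0 : ℝ) < n := by exact_mod_cast hn1
    have hcard : ((K n).card : ℝ) ≤ 3 * n := by exact_mod_cast card_le_three_mul hn1 (hK n)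
    rw [div_le_iff₀ (by positivity)]
    refine (norm_formFactorFluctuation_sub_le φ n (K n) u v p).trans ?_
    calc _ ≤ ‖formFactorFluctuation φ n (K n) (C * n) (gridWeight v (K n).card) p‖ +
          δ * (‖formFactorFluctuation φ n (K n) (C * n) (gridWeight (C := C) 1 (K n).card) p‖ +
            4 * C * n * (3 * n)) := by gcongr
      _ = _ := by field_simp; ring
  calc _ ≤ (1 / (N : ℝ)) * ∑ n ∈ Finset.Icc 1 N, _ :=
        mul_le_mul_of_nonneg_left (Finset.sum_le_sum hterm) (by positivity)
    _ = (1 / (N : ℝ)) * ∑ n ∈ Finset.Icc 1 N,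
          ‖formFactorFluctuation φ n (K n) (C * n) (gridWeight v (K n).card) p‖ / (n : ℝ) ^ 2 +
        δ * ((1 / (N : ℝ)) * ∑ n ∈ Finset.Icc 1 N,
          ‖formFactorFluctuation φ n (K n) (C * n) (gridWeight (C := C) 1 (K n).card) p‖ /
            (n : ℝ) ^ 2 + 12 * C) := by
        rw [Finset.sum_add_distrib, ← Finset.mul_sum, Finset.sum_add_distrib, Finset.sum_const,
          Nat.card_Icc, Nat.add_sub_cancel, nsmul_eq_mul]
        field_simp
    _ < ε / 2 + δ * (1 + 12 * C) := by gcongr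
    _ ≤ ε := by linarith

/-! ### Riemann sums and convergence for band-limited test functions -/

theorem continuous_fourier_of_integrable {f : ℝ → ℂ} (hf : Integrable f) :
    Continuous (FourierTransform.fourier f) :=
  VectorFourier.fourierIntegral_continuous Real.continuous_fourierChar
    (L := innerₗ ℝ) continuous_inner hf

theorem exists_nat_forall_lt_abs_eq_zero {F : ℝ → ℂ} (hF : HasCompactSupport F) :
    ∃ C : ℕ, ∀ x, (C : ℝ) < |x| → F x = 0 := by
  obtain ⟨r, hr⟩ := hF.isCompact.isBounded.subset_closedBall 0
  obtain ⟨C, hC⟩ := exists_nat_ge r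
  refine ⟨C, fun x hx => image_eq_zero_of_notMem_tsupport fun h => ?_⟩
  have h1 := hr h
  rw [Metric.mem_closedBall, dist_zero_right, Real.norm_eq_abs] at h1
  linarith

theorem measurable_comp_floor_div {F : ℝ → ℂ} (hF : Continuous F) (d : ℕ) :
    Measurable fun x : ℝ => F ((⌊(d : ℝ) * x⌋ : ℝ) / d) := by
  have : Measurable fun x : ℝ => ⌊(d : ℝ) * x⌋ := Int.measurable_floor.comp (by fun_prop)
  have h2 : Measurable fun z : ℤ => ((z : ℝ) / d) := measurable_from_top
  exact hF.measurable.comp (h2.comp this)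

theorem abs_floor_mul_div_sub_le {d : ℕ} (hd : 1 ≤ d) (x : ℝ) :
    |(⌊(d : ℝ) * x⌋ : ℝ) / d - x| ≤ 1 / d := by
  have hd0 : (0 : ℝ) < d := by exact_mod_cast hd
  have e : (⌊(d : ℝ) * x⌋ : ℝ) / d - x = (⌊(d : ℝ) * x⌋ - d * x) / d := by
    field_simp
  rw [e, abs_div, abs_of_pos hd0]
  gcongr
  rw [abs_le]
  constructor <;> linarith [Int.floor_le ((d : ℝ) * x), Int.lt_floor_add_one ((d : ℝ) * x)]

theorem norm_comp_floor_div_le {F : ℝ → ℂ} {B : ℝ} (hB : ∀ x, ‖F x‖ ≤ B) {C : ℕ}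
    (hC : ∀ x, (C : ℝ) < |x| → F x = 0) {d : ℕ} (hd : 1 ≤ d) (x : ℝ) :
    ‖F ((⌊(d : ℝ) * x⌋ : ℝ) / d)‖ ≤ (Set.Icc (-(C + 1 : ℝ)) (C + 1)).indicator (fun _ => B) x := by
  by_cases hx : x ∈ Set.Icc (-(C + 1 : ℝ)) (C + 1)
  · rw [Set.indicator_of_mem hx]
    exact hB _
  · rw [Set.indicator_of_notMem hx, hC, norm_zero]
    have h1 := abs_floor_mul_div_sub_le hd x
    have h2 : 1 / (d : ℝ) ≤ 1 := by
      rw [div_le_one₀ (by exact_mod_cast hd)]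
      exact_mod_cast hd
    have h3 : (C + 1 : ℝ) < |x| := by
      rw [Set.mem_Icc, ← abs_le] at hx
      exact not_le.1 hx
    have h4 := abs_sub_abs_le_abs_sub x ((⌊(d : ℝ) * x⌋ : ℝ) / d)
    rw [abs_sub_comm] at h4
    linarith

theorem integrable_indicator_Icc_const (a b B : ℝ) :
    Integrable ((Set.Icc a b).indicator fun _ => B) :=
  (integrable_indicator_iff measurableSet_Icc).2 (by simp)

/-- The rounded function is constant on cells of length 1 / d, so the Riemann sum is an integral to
which dominated convergence applies. -/
theorem integral_comp_floor_div {F : ℝ → ℂ} (hF : Continuous F) (hFc : HasCompactSupport F)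
    {d : ℕ} (hd : 1 ≤ d) :
    ∫ x : ℝ, F ((⌊(d : ℝ) * x⌋ : ℝ) / d) = (1 / (d : ℂ)) * ∑' ℓ : ℤ, F ((ℓ : ℝ) / d) := by
  have hd0 : (0 : ℝ) < d := by exact_mod_cast hd
  obtain ⟨C, hC⟩ := exists_nat_forall_lt_abs_eq_zero hFc
  obtain ⟨B, hB⟩ := hF.bounded_above_of_compact_support hFc
  have hint : Integrable fun x : ℝ => F ((⌊(d : ℝ) * x⌋ : ℝ) / d) :=
    (integrable_indicator_Icc_const _ _ B).mono'
      (measurable_comp_floor_div hF d).aestronglyMeasurable (ae_of_all _ (norm_comp_floor_div_le hB hC hd))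
  have hint' : Integrable fun y : ℝ => F ((⌊y⌋ : ℝ) / d) := by
    have := (integrable_comp_mul_left_iff (fun y : ℝ => F ((⌊y⌋ : ℝ) / d)) hd0.ne').1 hint
    exact this
  have h1 := Measure.integral_comp_mul_left (fun y : ℝ => F ((⌊y⌋ : ℝ) / d)) (d : ℝ)
  have h2 := hasSum_integral_iUnion (μ := volume) (fun n : ℤ => measurableSet_Ico
    (a := (n : ℝ)) (b := n + 1)) (Set.pairwise_disjoint_Ico_intCast ℝ)
    (f := fun y : ℝ => F ((⌊y⌋ : ℝ) / d)) hint'.integrableOn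
  rw [iUnion_Ico_intCast, setIntegral_univ] at h2
  have h3 : ∀ n : ℤ, ∫ y in Set.Ico (n : ℝ) (n + 1), F ((⌊y⌋ : ℝ) / d) = F ((n : ℝ) / d) := by
    intro n
    rw [setIntegral_congr_fun measurableSet_Ico (g := fun _ => F ((n : ℝ) / d))]
    · simp
    · intro y hy
      dsimp only
      rw [Int.floor_eq_iff.2 ⟨hy.1, hy.2⟩]
  simp_rw [h3] at h2
  rw [h1, ← h2.tsum_eq, abs_of_pos (inv_pos.2 hd0), Complex.real_smul]
  simp

/-- Riemann sums over the lattice `ℤ / d` converge to the integral. -/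
theorem tendsto_riemannSum {F : ℝ → ℂ} (hF : Continuous F) (hFc : HasCompactSupport F) :
    Tendsto (fun d : ℕ => (1 / (d : ℂ)) * ∑' ℓ : ℤ, F ((ℓ : ℝ) / d)) atTop (𝓝 (∫ x, F x)) := by
  obtain ⟨C, hC⟩ := exists_nat_forall_lt_abs_eq_zero hFc
  obtain ⟨B, hB⟩ := hF.bounded_above_of_compact_support hFc
  have h1 : Tendsto (fun d : ℕ => ∫ x : ℝ, F ((⌊(d : ℝ) * x⌋ : ℝ) / d)) atTop (𝓝 (∫ x, F x)) := by
    refine tendsto_integral_filter_of_dominated_convergence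
      ((Set.Icc (-(C + 1 : ℝ)) (C + 1)).indicator fun _ => B)
      (Eventually.of_forall fun d => (measurable_comp_floor_div hF d).aestronglyMeasurable)
      ?_ (integrable_indicator_Icc_const _ _ B) (ae_of_all _ fun x => ?_)
    · filter_upwards [eventually_ge_atTop 1] with d hd
      exact ae_of_all _ (norm_comp_floor_div_le hB hC hd)
    · refine (hF.tendsto x).comp (tendsto_iff_dist_tendsto_zero.2 ?_)
      refine squeeze_zero' (Eventually.of_forall fun _ => dist_nonneg) ?_
        tendsto_one_div_atTop_nhds_zero_nat
      filter_upwards [eventually_ge_atTop 1] with d hd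
      rw [Real.dist_eq]
      exact abs_floor_mul_div_sub_le hd x
  refine h1.congr' ?_
  filter_upwards [eventually_ge_atTop 1] with d hd
  exact integral_comp_floor_div hF hFc hd

theorem tsum_eq_sum_nonzeroIcc {G : ℤ → ℂ} {M : ℕ} (hG : ∀ ℓ : ℤ, (M : ℤ) < |ℓ| → G ℓ = 0) :
    ∑' ℓ, G ℓ = G 0 + ∑ ℓ ∈ nonzeroIcc M, G ℓ := by
  rw [tsum_eq_sum (s := Finset.Icc (-(M : ℤ)) M), nonzeroIcc, Finset.add_sum_erase]
  · simp
  · intro ℓ hℓ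
    refine hG ℓ (not_le.1 fun h => hℓ ?_)
    rwa [Finset.mem_Icc, ← abs_le]

theorem expSum_zero (φ : Polynomial ℝ) (α β : ℝ) (n : ℕ) (K : Finset ℤ) :
    expSum φ α β n K 0 = K.card := by
  simp [expSum]

theorem lt_abs_div_card {n : ℕ} (hn : 1 ≤ n) {K : Finset ℤ} (hK : K ⊆ allLevels n)
    (hd : n ≤ K.card) {C : ℕ} {ℓ : ℤ} (hℓ : ((3 * C * n : ℕ) : ℤ) < |ℓ|) :
    (C : ℝ) < |(ℓ : ℝ) / K.card| := by
  have hcard : (K.card : ℝ) ≤ 3 * n := by exact_mod_cast card_le_three_mul hn hK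
  have hd0 : (0 : ℝ) < K.card := by exact_mod_cast hn.trans hd
  have hℓ' : (3 * C * n : ℝ) < |(ℓ : ℝ)| := by exact_mod_cast hℓ
  rw [abs_div, Nat.abs_cast, lt_div_iff₀ hd0]
  have : (C : ℝ) * K.card ≤ C * (3 * n) := by gcongr
  linarith

theorem abs_div_card_le {n : ℕ} (hn : 1 ≤ n) {K : Finset ℤ} (hd : n ≤ K.card) {C : ℕ} {ℓ : ℤ}
    (hℓ : |ℓ| ≤ ((C * n : ℕ) : ℤ)) : |(ℓ : ℝ) / K.card| ≤ C := by
  have hd0 : (0 : ℝ) < K.card := by exact_mod_cast hn.trans hd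
  have hd' : (n : ℝ) ≤ K.card := by exact_mod_cast hd
  have hℓ' : |(ℓ : ℝ)| ≤ (C * n : ℝ) := by exact_mod_cast hℓ
  rw [abs_div, Nat.abs_cast, div_le_iff₀ hd0]
  exact hℓ'.trans (by gcongr)

/-- The three summands are the term ℓ = 0, the Riemann sum without its term ℓ = 0 (each squared
trace replaced by d), and the fluctuation. As n ≤ d ≤ 3n, the cutoff 3Cn contains every ℓ with |ℓ| /
d ≤ C, and all its points satisfy |ℓ| / d ≤ 3C. -/
theorem pairCorrelation_eq (φ : Polynomial ℝ) (α β : ℝ) {n : ℕ} (hn : 1 ≤ n) {K : Finset ℤ}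
    (hK : K ⊆ allLevels n) (hd : n ≤ K.card) (f : ℝ → ℂ) {C : ℕ}
    (hC : ∀ x, (C : ℝ) < |x| → FourierTransform.fourier f x = 0)
    (u : C(Set.Icc (-((3 * C : ℕ) : ℝ)) (3 * C : ℕ), ℂ))
    (hu : ∀ x, u x = FourierTransform.fourier f x) :
    pairCorrelation φ α β n K f = FourierTransform.fourier f 0 +
      ((1 / (K.card : ℂ)) * ∑' ℓ : ℤ, FourierTransform.fourier f ((ℓ : ℝ) / K.card) -
        (1 / (K.card : ℂ)) * FourierTransform.fourier f 0) +
      (1 / (K.card : ℂ) ^ 2) *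
        formFactorFluctuation φ n K (3 * C * n) (gridWeight u K.card) (α, β) := by
  have hd0 : (K.card : ℂ) ≠ 0 := Nat.cast_ne_zero.2 (Nat.one_le_iff_ne_zero.1 (hn.trans hd))
  have hz : ∀ ℓ : ℤ, ((3 * C * n : ℕ) : ℤ) < |ℓ| →
      FourierTransform.fourier f ((ℓ : ℝ) / K.card) = 0 :=
    fun ℓ hℓ => hC _ (lt_abs_div_card hn hK hd hℓ)
  rw [pairCorrelation, tsum_eq_sum_nonzeroIcc (M := 3 * C * n)
    fun ℓ hℓ => by rw [hz ℓ hℓ, zero_mul], tsum_eq_sum_nonzeroIcc (M := 3 * C * n) hz]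
  have hw : ∀ ℓ ∈ nonzeroIcc (3 * C * n), gridWeight u K.card ℓ =
      FourierTransform.fourier f ((ℓ : ℝ) / K.card) := by
    intro ℓ hℓ
    have h1 := abs_div_card_le hn hd (C := 3 * C) (mem_nonzeroIcc.1 hℓ).2
    rw [gridWeight, Set.projIcc_of_mem _ (abs_le.1 h1), hu]
  simp_rw [trace_quantumMap_zpow, expSum_zero]
  have hff : formFactorFluctuation φ n K (3 * C * n) (gridWeight u K.card) (α, β) =
      ∑ ℓ ∈ nonzeroIcc (3 * C * n), FourierTransform.fourier f ((ℓ : ℝ) / K.card) *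
        ((‖expSum φ α β n K ℓ‖ ^ 2 - K.card : ℝ) : ℂ) :=
    Finset.sum_congr rfl fun ℓ hℓ => by rw [hw ℓ hℓ]
  rw [hff]
  simp_rw [Complex.ofReal_sub, mul_sub, Finset.sum_sub_distrib, ← Finset.sum_mul]
  simp only [Int.cast_zero, zero_div, Complex.norm_natCast, Complex.ofReal_pow,
    Complex.ofReal_natCast]
  field_simp
  ring

theorem tendsto_average {u : ℕ → ℂ} {l : ℂ} (h : Tendsto u atTop (𝓝 l)) :
    Tendsto (fun N : ℕ => (1 / (N : ℂ)) * ∑ n ∈ Finset.Icc 1 N, u n) atTop (𝓝 l) := by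
  refine ((tendsto_add_atTop_iff_nat 1).2 h).cesaro_smul.congr fun N => ?_
  rw [Complex.real_smul, Finset.range_eq_Ico, Finset.sum_Ico_add' u 0 N 1, zero_add,
    Finset.Ico_add_one_right_eq_Icc]
  simp

theorem tendsto_averagedPairCorrelation (φ : Polynomial ℝ) (α β : ℝ) {K : ℕ → Finset ℤ}
    (hK : ∀ n, K n ⊆ allLevels n) (hd : ∀ n, n ≤ (K n).card)
    (h : FluctuationsVanish φ K (α, β)) {f : ℝ → ℂ} (hf : Continuous f) (hfi : Integrable f)
    (hfc : HasCompactSupport (FourierTransform.fourier f)) :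
    Tendsto (fun N : ℕ => averagedPairCorrelation φ α β K N f) atTop
      (𝓝 (f 0 + ∫ x, f x)) := by
  have hF := continuous_fourier_of_integrable hfi
  have hF0 : FourierTransform.fourier f 0 = ∫ x, f x := by simp [Real.fourier_eq]
  -- Fourier inversion at 0: the limit of the Riemann sums is the atom of the Poisson measure.
  have hFint : ∫ x, FourierTransform.fourier f x = f 0 := by
    have h1 := congrFun (hf.fourierInv_fourier_eq hfi (hF.integrable_of_hasCompactSupport hfc)) 0
    rw [← h1, Real.fourierInv_eq]
    simp
  obtain ⟨C, hC⟩ := exists_nat_forall_lt_abs_eq_zero hfc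
  set F := FourierTransform.fourier f with hFdef
  set u : C(Set.Icc (-((3 * C : ℕ) : ℝ)) (3 * C : ℕ), ℂ) := ⟨fun x => F x, by fun_prop⟩ with hu
  have hcard : Tendsto (fun n => (K n).card) atTop atTop :=
    tendsto_atTop_mono hd tendsto_id
  have h1 : Tendsto (fun n : ℕ => F 0 + ((1 / ((K n).card : ℂ)) * ∑' ℓ : ℤ, F ((ℓ : ℝ) / (K n).card)
      - (1 / ((K n).card : ℂ)) * F 0)) atTop (𝓝 (f 0 + ∫ x, f x)) := by
    have h2 := (tendsto_riemannSum hF hfc).comp hcard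
    have h3 : Tendsto (fun d : ℕ => 1 / (d : ℂ)) atTop (𝓝 0) :=
      tendsto_one_div_atTop_nhds_zero_nat
    have h4 := (h2.sub ((h3.comp hcard).mul_const (F 0))).const_add (F 0)
    rw [zero_mul, sub_zero, hFint, add_comm (F 0) (f 0), hF0] at h4
    rw [hF0]
    exact h4
  have h5 : Tendsto (fun N : ℕ => (1 / (N : ℂ)) * ∑ n ∈ Finset.Icc 1 N, (1 / ((K n).card : ℂ) ^ 2) *
      formFactorFluctuation φ n (K n) (3 * C * n) (gridWeight u (K n).card) (α, β))
      atTop (𝓝 0) := by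
    refine squeeze_zero_norm (fun N => ?_) (h (3 * C) u)
    rw [norm_mul, norm_div, norm_one, Complex.norm_natCast]
    gcongr
    refine (norm_sum_le _ _).trans (Finset.sum_le_sum fun n hn => ?_)
    have hn1 := (Finset.mem_Icc.1 hn).1
    have hn0 : (0 : ℝ) < n := by exact_mod_cast hn1
    have hd' : (n : ℝ) ≤ (K n).card := by exact_mod_cast hd n
    rw [norm_mul, norm_div, norm_one, norm_pow, Complex.norm_natCast, one_div_mul_eq_div]
    gcongr
  have h6 := (tendsto_average h1).add h5
  rw [add_zero] at h6
  refine h6.congr fun N => ?_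
  rw [averagedPairCorrelation, ← mul_add, ← Finset.sum_add_distrib]
  congr 1
  refine Finset.sum_congr rfl fun n hn => ?_
  exact (pairCorrelation_eq φ α β (Finset.mem_Icc.1 hn).1 (hK n) (hd n) f hC u fun _ => rfl).symm

theorem integral_poissonPairCorrelation {f : ℝ → ℂ} (hfi : Integrable f) :
    ∫ x, f x ∂poissonPairCorrelation = f 0 + ∫ x, f x := by
  rw [poissonPairCorrelation, integral_add_measure (integrable_dirac (by simp)) hfi,
    integral_dirac]

/-! ### A nonnegative band-limited function, positive on a given interval -/

/-- The bump is real and even, so its Fourier transform is real. -/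
theorem conj_fourier_bump (b : ContDiffBump (0 : ℝ)) (x : ℝ) :
    (starRingEnd ℂ) (FourierTransform.fourier (fun y => ((b y : ℝ) : ℂ)) x) =
      FourierTransform.fourier (fun y => ((b y : ℝ) : ℂ)) x := by
  rw [Real.fourier_real_eq_integral_exp_smul, ← integral_conj,
    ← integral_neg_eq_self fun y : ℝ => (starRingEnd ℂ) _]
  refine integral_congr_ae (ae_of_all _ fun y => ?_)
  dsimp only
  rw [b.neg, smul_eq_mul, smul_eq_mul, map_mul, Complex.conj_ofReal, ← Complex.exp_conj]
  congr 2
  rw [map_mul, Complex.conj_ofReal, Complex.conj_I]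
  push_cast
  ring

/-- On the support of the bump the argument of the cosine is at most 2π/8 = π/4 in absolute value,
so the integrand is nonnegative, and it is positive at 0. -/
theorem fourier_bump_re_pos (b : ContDiffBump (0 : ℝ)) {x : ℝ} (hx : |x| * b.rOut ≤ 1 / 8) :
    0 < (FourierTransform.fourier (fun y => ((b y : ℝ) : ℂ)) x).re := by
  have hc : Continuous fun y : ℝ => b y * Real.cos (2 * Real.pi * y * x) := by
    have := b.continuous
    fun_prop
  have hsupp : HasCompactSupport fun y : ℝ => b y * Real.cos (2 * Real.pi * y * x) :=
    b.hasCompactSupport.mul_right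
  have h1 : (FourierTransform.fourier (fun y => ((b y : ℝ) : ℂ)) x).re =
      ∫ y : ℝ, b y * Real.cos (2 * Real.pi * y * x) := by
    rw [Real.fourier_real_eq_integral_exp_smul]
    set E : ℝ → ℂ := fun y : ℝ => Complex.exp (((-2 * Real.pi * y * x : ℝ) : ℂ) * Complex.I) •
        ((b y : ℝ) : ℂ) with hE
    have hi : Integrable E := by
      refine Continuous.integrable_of_hasCompactSupport ?_ ?_
      · have := b.continuous
        fun_prop
      · refine HasCompactSupport.intro b.hasCompactSupport.isCompact fun y hy => ?_
        have hz : b y = 0 := image_eq_zero_of_notMem_tsupport hy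
        dsimp only [E]
        rw [hz, Complex.ofReal_zero, smul_zero]
    have h2 : (∫ y, E y).re = ∫ y, (E y).re := (integral_re hi).symm
    rw [h2]
    refine integral_congr_ae (ae_of_all _ fun y => ?_)
    dsimp only [E]
    rw [smul_eq_mul, Complex.re_mul_ofReal, Complex.exp_ofReal_mul_I_re, mul_comm,
      ← Real.cos_neg]
    congr 2
    ring
  rw [h1]
  refine (hc.integral_pos_of_hasCompactSupport_nonneg_nonzero hsupp (fun y => ?_) (x := 0) ?_)
  · dsimp only [Pi.zero_apply]
    by_cases hy : y ∈ Metric.ball (0 : ℝ) b.rOut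
    · refine mul_nonneg b.nonneg (Real.cos_nonneg_of_mem_Icc (abs_le.1 ?_))
      rw [Metric.mem_ball, dist_zero_right, Real.norm_eq_abs] at hy
      have h3 : |y| * |x| ≤ 1 / 8 := by
        rw [mul_comm]
        exact (mul_le_mul_of_nonneg_left hy.le (abs_nonneg x)).trans hx
      rw [abs_mul, abs_mul, abs_of_pos Real.two_pi_pos, mul_assoc]
      nlinarith [Real.pi_pos]
    · rw [← b.support_eq, Function.notMem_support] at hy
      rw [hy, zero_mul]
  · simp only [mul_zero, zero_mul, Real.cos_zero, mul_one]
    exact (b.pos_of_mem_ball (Metric.mem_ball_self b.rOut_pos)).ne'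

/-- The square of the Fourier transform of a bump, supported so close to 0 that the transform has no
zero on [-R, R]. -/
theorem exists_bandlimited_pos (R : ℝ) :
    ∃ g : ℝ → ℝ, Continuous g ∧ (∀ x, 0 ≤ g x) ∧ (∀ x, |x| ≤ R → 0 < g x) ∧ Integrable g ∧
      ((fun x => (g x : ℂ)) =O[cocompact ℝ] fun x => |x| ^ (-2 : ℝ)) ∧
      HasCompactSupport (FourierTransform.fourier fun x => (g x : ℂ)) := by
  set r : ℝ := 1 / (8 * (|R| + 1)) with hr
  have hr0 : 0 < r := by positivity
  set b : ContDiffBump (0 : ℝ) := ⟨r / 2, r, by positivity, by linarith⟩ with hb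
  set ψ : ℝ → ℂ := fun y => ((b y : ℝ) : ℂ) with hψ
  have hψc : Continuous ψ := Complex.continuous_ofReal.comp b.continuous
  have hψs : HasCompactSupport ψ :=
    b.hasCompactSupport.comp_left (g := ((↑) : ℝ → ℂ)) Complex.ofReal_zero
  have hψd : ContDiff ℝ ((⊤ : ℕ∞) : WithTop ℕ∞) ψ := Complex.ofRealCLM.contDiff.comp b.contDiff
  set S : SchwartzMap ℝ ℂ := hψs.toSchwartzMap hψd with hS
  set T : SchwartzMap ℝ ℂ := FourierTransform.fourier S with hT
  have hTψ : ∀ x, T x = FourierTransform.fourier ψ x := fun x => by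
    rw [hT, SchwartzMap.fourier_coe]
    rfl
  have hψi : Integrable ψ := hψc.integrable_of_hasCompactSupport hψs
  have hre : ∀ x, (((T x).re : ℝ) : ℂ) = T x := fun x => by
    rw [hTψ]
    exact Complex.conj_eq_iff_re.1 (conj_fourier_bump b x)
  have hsq : ∀ x, (((T x).re ^ 2 : ℝ) : ℂ) = T x * T x := fun x => by
    rw [Complex.ofReal_pow, hre, sq]
  have hO := T.isBigO_cocompact_rpow (-1)
  have hTi : Integrable fun x => T x * T x :=
    T.integrable.mul_bdd (c := (SchwartzMap.seminorm ℝ 0 0) T)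
      T.continuous.aestronglyMeasurable (ae_of_all _ (T.norm_le_seminorm ℝ))
  refine ⟨fun x => (T x).re ^ 2, by fun_prop, fun x => sq_nonneg _, fun x hx => ?_, ?_, ?_, ?_⟩
  · refine pow_pos ?_ 2
    rw [hTψ]
    refine fourier_bump_re_pos b ?_
    change |x| * r ≤ 1 / 8
    rw [hr, mul_one_div, div_le_div_iff₀ (by positivity) (by norm_num)]
    linarith [le_abs_self R]
  · have h1 := hTi.re
    refine h1.congr (ae_of_all _ fun x => ?_)
    dsimp only
    rw [← hsq]
    exact Complex.ofReal_re _
  · have h1 := hO.mul hO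
    refine (h1.congr_left fun x => (hsq x).symm).trans (Asymptotics.IsBigO.of_bound 1 ?_)
    have hne : ∀ᶠ x : ℝ in cocompact ℝ, x ≠ 0 :=
      (isCompact_singleton (x := (0 : ℝ))).compl_mem_cocompact
    filter_upwards [hne] with x hx
    rw [one_mul, Real.norm_eq_abs x, ← Real.rpow_add (abs_pos.2 hx)]
    norm_num
  -- The Fourier transform of the self-convolution w is g, hence that of g is the reflection of w,
  -- which has compact support.
  · set w : ℝ → ℂ := convolution ψ ψ (ContinuousLinearMap.mul ℂ ℂ) volume with hw
    have hwc : Continuous w :=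
      hψs.continuous_convolution_right (ContinuousLinearMap.mul ℂ ℂ)
        (hψc.locallyIntegrable) hψc
    have hws : HasCompactSupport w := hψs.convolution _ hψs
    have hFw : FourierTransform.fourier w = fun x => (((T x).re ^ 2 : ℝ) : ℂ) := by
      funext x
      rw [hsq, hTψ]
      exact Real.fourier_mul_convolution_eq hψi hψi x
    have hinv := hwc.fourierInv_fourier_eq (hwc.integrable_of_hasCompactSupport hws)
      (by rw [hFw]; exact hTi.congr (ae_of_all _ fun x => (hsq x).symm))
    rw [← hFw]
    have h2 : FourierTransform.fourier (FourierTransform.fourier w) = fun x => w (-x) := by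
      funext x
      rw [← hinv, Real.fourierInv_eq_fourier_neg, neg_neg]
      rw [hinv]
    rw [h2]
    exact hws.comp_homeomorph (Homeomorph.neg ℝ)

/-! ### Poisson summation: the functional is integration against the measure -/

theorem fourier_mul_exp (g : ℝ → ℂ) (t ξ : ℝ) :
    FourierTransform.fourier (fun x : ℝ => g x * Complex.exp (t * x * Complex.I)) ξ =
      FourierTransform.fourier g (ξ - t / (2 * Real.pi)) := by
  rw [Real.fourier_real_eq_integral_exp_smul, Real.fourier_real_eq_integral_exp_smul]
  refine integral_congr_ae (ae_of_all _ fun x => ?_)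
  dsimp only
  rw [smul_eq_mul, smul_eq_mul, mul_left_comm, ← Complex.exp_add, mul_comm]
  congr 2
  have : (Real.pi : ℂ) ≠ 0 := by exact_mod_cast Real.pi_ne_zero
  push_cast
  field_simp
  ring

theorem hasCompactSupport_fourier_mul_exp {g : ℝ → ℂ}
    (hg : HasCompactSupport (FourierTransform.fourier g)) (t : ℝ) :
    HasCompactSupport
      (FourierTransform.fourier fun x : ℝ => g x * Complex.exp (t * x * Complex.I)) := by
  have h1 := hg.comp_homeomorph (Homeomorph.subRight (t / (2 * Real.pi)))
  convert h1 using 1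
  funext ξ
  exact fourier_mul_exp g t ξ

theorem fourier_comp_mul_left (f : ℝ → ℂ) {d : ℝ} (hd : 0 < d) (ξ : ℝ) :
    FourierTransform.fourier (fun x : ℝ => f (d * x)) ξ =
      (1 / (d : ℂ)) * FourierTransform.fourier f (ξ / d) := by
  rw [Real.fourier_real_eq_integral_exp_smul, Real.fourier_real_eq_integral_exp_smul]
  have h1 := Measure.integral_comp_mul_left (fun y : ℝ =>
    Complex.exp (((-2 * Real.pi * y * (ξ / d) : ℝ) : ℂ) * Complex.I) • f y) d
  rw [abs_of_pos (inv_pos.2 hd), Complex.real_smul, Complex.ofReal_inv, ← one_div] at h1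
  rw [← h1]
  refine integral_congr_ae (ae_of_all _ fun x => ?_)
  dsimp only
  congr 4
  field_simp

theorem summable_comp_div_of_hasCompactSupport {F : ℝ → ℂ} (hF : HasCompactSupport F) {d : ℝ}
    (hd : 0 < d) (w : ℤ → ℂ) : Summable fun ℓ : ℤ => F ((ℓ : ℝ) / d) * w ℓ := by
  obtain ⟨C, hC⟩ := exists_nat_forall_lt_abs_eq_zero hF
  refine summable_of_ne_finset_zero (s := Finset.Icc (-⌈C * d⌉) ⌈C * d⌉) fun ℓ hℓ => ?_
  rw [hC, zero_mul]
  rw [Finset.mem_Icc, ← abs_le, not_le] at hℓ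
  have h1 : (⌈C * d⌉ : ℝ) < |(ℓ : ℝ)| := by exact_mod_cast hℓ
  rw [abs_div, abs_of_pos hd, lt_div_iff₀ hd]
  exact (Int.le_ceil _).trans_lt h1

theorem isBigO_comp_mul_left {f : ℝ → ℂ} {b : ℝ} (hO : f =O[cocompact ℝ] fun x => |x| ^ b)
    {d : ℝ} (hd : 0 < d) : (fun x => f (d * x)) =O[cocompact ℝ] fun x => |x| ^ b := by
  have h1 : Tendsto (fun x : ℝ => d * x) (cocompact ℝ) (cocompact ℝ) :=
    (Homeomorph.mulLeft₀ d hd.ne').isClosedEmbedding.tendsto_cocompact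
  refine (hO.comp_tendsto h1).trans (Asymptotics.IsBigO.of_bound (d ^ b) ?_)
  refine Eventually.of_forall fun x => ?_
  rw [Function.comp_apply, abs_mul, abs_of_pos hd, Real.mul_rpow hd.le (abs_nonneg x), norm_mul,
    Real.norm_of_nonneg (Real.rpow_nonneg hd.le b)]

theorem summable_comp_mul_add_int {f : ℝ → ℂ} (hf : Continuous f)
    (hO : f =O[cocompact ℝ] fun x => |x| ^ (-2 : ℝ)) {d : ℝ} (hd : 0 < d) (θ : ℝ) :
    Summable fun m : ℤ => ‖f (d * (θ + m))‖ := by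
  set h : C(ℝ, ℂ) := ⟨fun x => f (d * x), by fun_prop⟩ with hh
  -- The decay of sup norms over translated compact sets, used for the one-point set {θ}, is the
  -- pointwise decay needed here.
  have h1 := summable_of_isBigO (Real.summable_abs_int_rpow (b := 2) one_lt_two)
    ((isBigO_norm_restrict_cocompact h zero_lt_two (isBigO_comp_mul_left hO hd)
      ⟨{θ}, isCompact_singleton⟩).comp_tendsto Int.tendsto_coe_cofinite)
  refine Summable.of_nonneg_of_le (fun m => norm_nonneg _) (fun m => ?_) h1
  exact ((h.comp (ContinuousMap.addRight (m : ℝ))).restrict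
    ({θ} : Set ℝ)).norm_coe_le_norm ⟨θ, rfl⟩

theorem tsum_comp_mul_add_int {f : ℝ → ℂ} (hf : Continuous f)
    (hO : f =O[cocompact ℝ] fun x => |x| ^ (-2 : ℝ))
    (hFc : HasCompactSupport (FourierTransform.fourier f)) {d : ℝ} (hd : 0 < d) (θ : ℝ) :
    ∑' m : ℤ, f (d * (θ + m)) = (1 / (d : ℂ)) * ∑' ℓ : ℤ, FourierTransform.fourier f ((ℓ : ℝ) / d) *
      Complex.exp (Complex.I * ((2 * Real.pi * ℓ * θ : ℝ) : ℂ)) := by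
  have h1 := Real.tsum_eq_tsum_fourier_of_rpow_decay_of_summable
    (f := fun x => f (d * x)) (by fun_prop) one_lt_two (isBigO_comp_mul_left hO hd) ?_ θ
  · rw [h1, ← tsum_mul_left]
    refine tsum_congr fun ℓ => ?_
    rw [fourier_comp_mul_left f hd, mul_assoc, fourier_coe_apply]
    congr 3
    push_cast
    ring_nf
  · simp_rw [fourier_comp_mul_left f hd, mul_comm (1 / (d : ℂ))]
    exact summable_comp_div_of_hasCompactSupport hFc hd _

theorem integrable_sum_dirac_comp {f : ℝ → ℂ} (hf : Continuous f)
    (hO : f =O[cocompact ℝ] fun x => |x| ^ (-2 : ℝ)) {d : ℝ} (hd : 0 < d) (θ : ℝ) :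
    Integrable f (Measure.sum fun m : ℤ => Measure.dirac (d * (θ + (m : ℝ)))) := by
  refine integrable_sum_measure (fun m => integrable_dirac (by simp)) ?_
  simp_rw [integral_dirac]
  exact summable_comp_mul_add_int hf hO hd θ

theorem integrable_pairCorrelationMeasure (φ : Polynomial ℝ) (α β : ℝ) (n : ℕ) {K : Finset ℤ}
    (hK : 0 < K.card) {f : ℝ → ℂ} (hf : Continuous f)
    (hO : f =O[cocompact ℝ] fun x => |x| ^ (-2 : ℝ)) :
    Integrable f (pairCorrelationMeasure φ α β n K) := by
  have hd : (0 : ℝ) < K.card := by exact_mod_cast hK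
  refine Integrable.smul_measure ?_ (ENNReal.inv_ne_top.2 (by exact_mod_cast hK.ne'))
  exact integrable_finsetSum_measure.2 fun j _ => integrable_finsetSum_measure.2 fun k _ =>
    integrable_sum_dirac_comp hf hO hd _

theorem eigenphase_eq (φ : Polynomial ℝ) (α β : ℝ) (n : ℕ) (k : ℤ) :
    eigenphase φ α β n k = levelPhase φ α β n k / (2 * Real.pi) := rfl

/-- Poisson summation in m for each pair of levels produces the sum over ℓ, and summing over pairs
reassembles |Tr U^ℓ|². Of the two factors 1 / d, one is the normalization and one comes from the
dilation by d. -/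
theorem integral_pairCorrelationMeasure (φ : Polynomial ℝ) (α β : ℝ) (n : ℕ) {K : Finset ℤ}
    (hK : 0 < K.card) {f : ℝ → ℂ} (hf : Continuous f)
    (hO : f =O[cocompact ℝ] fun x => |x| ^ (-2 : ℝ))
    (hFc : HasCompactSupport (FourierTransform.fourier f)) :
    ∫ x, f x ∂pairCorrelationMeasure φ α β n K = pairCorrelation φ α β n K f := by
  have hd : (0 : ℝ) < K.card := by exact_mod_cast hK
  have hi := fun θ => integrable_sum_dirac_comp hf hO hd θ
  have h1 : ∀ j k : ℤ, ∫ x, f x ∂(Measure.sum fun m : ℤ => Measure.dirac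
      ((K.card : ℝ) * (eigenphase φ α β n j - eigenphase φ α β n k + (m : ℝ)))) =
      (1 / (K.card : ℂ)) * ∑' ℓ : ℤ, FourierTransform.fourier f ((ℓ : ℝ) / K.card) *
        Complex.exp (Complex.I *
          ((ℓ * levelPhase φ α β n j - ℓ * levelPhase φ α β n k : ℝ) : ℂ)) := by
    intro j k
    rw [integral_sum_measure (hi _)]
    simp_rw [integral_dirac]
    rw [tsum_comp_mul_add_int hf hO hFc hd, Complex.ofReal_natCast]
    congr 1
    refine tsum_congr fun ℓ => ?_
    congr 4
    rw [eigenphase_eq, eigenphase_eq]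
    field_simp [Real.pi_ne_zero]
  rw [pairCorrelationMeasure, integral_smul_measure, integral_finsetSum_measure
    fun j _ => integrable_finsetSum_measure.2 fun k _ => hi _]
  have h2 : ∀ j ∈ K, ∫ x, f x ∂(∑ k ∈ K, Measure.sum fun m : ℤ => Measure.dirac
      ((K.card : ℝ) * (eigenphase φ α β n j - eigenphase φ α β n k + (m : ℝ)))) =
      ∑ k ∈ K, (1 / (K.card : ℂ)) * ∑' ℓ : ℤ, FourierTransform.fourier f ((ℓ : ℝ) / K.card) *
        Complex.exp (Complex.I *
          ((ℓ * levelPhase φ α β n j - ℓ * levelPhase φ α β n k : ℝ) : ℂ)) := by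
    intro j _
    rw [integral_finsetSum_measure fun k _ => hi _]
    exact Finset.sum_congr rfl fun k _ => h1 j k
  rw [Finset.sum_congr rfl h2, pairCorrelation]
  simp_rw [← Finset.mul_sum]
  have hs := fun w => summable_comp_div_of_hasCompactSupport hFc hd w
  have h3 : ∀ j ∈ K, ∑ k ∈ K, ∑' ℓ : ℤ, FourierTransform.fourier f ((ℓ : ℝ) / K.card) *
        Complex.exp (Complex.I *
          ((ℓ * levelPhase φ α β n j - ℓ * levelPhase φ α β n k : ℝ) : ℂ)) =
      ∑' ℓ : ℤ, FourierTransform.fourier f ((ℓ : ℝ) / K.card) * ∑ k ∈ K,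
        Complex.exp (Complex.I *
          ((ℓ * levelPhase φ α β n j - ℓ * levelPhase φ α β n k : ℝ) : ℂ)) := by
    intro j _
    rw [← Summable.tsum_finsetSum fun k _ => hs _]
    simp_rw [Finset.mul_sum]
  rw [Finset.sum_congr rfl h3, ← Summable.tsum_finsetSum fun k _ => hs _]
  simp_rw [← Finset.mul_sum, trace_quantumMap_zpow, expSum, norm_sum_sq_eq, exp_I_mul_mul_conj]
  rw [ENNReal.toReal_inv, ENNReal.toReal_natCast, Complex.real_smul, ← mul_assoc]
  congr 1
  push_cast
  field_simp

theorem integrable_averagedPairCorrelationMeasure (φ : Polynomial ℝ) (α β : ℝ) {K : ℕ → Finset ℤ}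
    (hK : ∀ n, n ≤ (K n).card) {N : ℕ} (hN : 1 ≤ N) {f : ℝ → ℂ} (hf : Continuous f)
    (hO : f =O[cocompact ℝ] fun x => |x| ^ (-2 : ℝ)) :
    Integrable f (averagedPairCorrelationMeasure φ α β K N) := by
  refine Integrable.smul_measure ?_ (ENNReal.inv_ne_top.2 (by exact_mod_cast (by omega : N ≠ 0)))
  exact integrable_finsetSum_measure.2 fun n hn => integrable_pairCorrelationMeasure φ α β n
    ((Finset.mem_Icc.1 hn).1.trans (hK n)) hf hO

theorem integral_averagedPairCorrelationMeasure (φ : Polynomial ℝ) (α β : ℝ) {K : ℕ → Finset ℤ}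
    (hK : ∀ n, n ≤ (K n).card) (N : ℕ) {f : ℝ → ℂ} (hf : Continuous f)
    (hO : f =O[cocompact ℝ] fun x => |x| ^ (-2 : ℝ))
    (hFc : HasCompactSupport (FourierTransform.fourier f)) :
    ∫ x, f x ∂averagedPairCorrelationMeasure φ α β K N = averagedPairCorrelation φ α β K N f := by
  have hcard : ∀ n ∈ Finset.Icc 1 N, 0 < (K n).card := fun n hn =>
    (Finset.mem_Icc.1 hn).1.trans (hK n)
  rw [averagedPairCorrelationMeasure, integral_smul_measure, integral_finsetSum_measure
    fun n hn => integrable_pairCorrelationMeasure φ α β n (hcard n hn) hf hO,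
    averagedPairCorrelation, Finset.sum_congr rfl fun n hn =>
      integral_pairCorrelationMeasure φ α β n (hcard n hn) hf hO hFc,
    ENNReal.toReal_inv, ENNReal.toReal_natCast, Complex.real_smul]
  push_cast
  rw [one_div]

/-! ### Lévy continuity and vague convergence -/

theorem charFun_normalize {μ : FiniteMeasure ℝ} (hμ : μ ≠ 0) (t : ℝ) :
    charFun (μ.normalize : Measure ℝ) t = ((μ.mass : ℝ) : ℂ)⁻¹ * charFun (μ : Measure ℝ) t := by
  rw [charFun_apply, charFun_apply, μ.toMeasure_normalize_eq_of_nonzero hμ,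
    integral_smul_nnreal_measure, NNReal.smul_def, Complex.real_smul]
  simp

/-- Lévy's continuity theorem for finite measures. -/
theorem tendsto_finiteMeasure_of_tendsto_charFun {μs : ℕ → FiniteMeasure ℝ} {μ : FiniteMeasure ℝ}
    (hμ : μ ≠ 0) (h : ∀ t : ℝ, Tendsto (fun n => charFun (μs n : Measure ℝ) t) atTop
      (𝓝 (charFun (μ : Measure ℝ) t))) :
    Tendsto μs atTop (𝓝 μ) := by
  have e : ∀ ν : FiniteMeasure ℝ, charFun (ν : Measure ℝ) 0 = ((ν.mass : ℝ) : ℂ) := fun ν => by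
    rw [charFun_zero]
    rfl
  -- The characteristic functions at t = 0 give convergence of the masses; the normalized measures
  -- then fall under the theorem for probability measures.
  have hmass : Tendsto (fun n => (μs n).mass) atTop (𝓝 μ.mass) := by
    have h0 := h 0
    simp_rw [e] at h0
    have h1 := (Complex.continuous_re.tendsto _).comp h0
    exact NNReal.tendsto_coe.1 h1
  have hne : ∀ᶠ n in atTop, μs n ≠ 0 := by
    filter_upwards [hmass.eventually_ne ((FiniteMeasure.mass_nonzero_iff μ).2 hμ)] with n hn
    exact (FiniteMeasure.mass_nonzero_iff _).1 hn
  refine FiniteMeasure.tendsto_of_tendsto_normalize_testAgainstNN_of_tendsto_mass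
    (ProbabilityMeasure.tendsto_of_tendsto_charFun fun t => ?_) hmass
  rw [charFun_normalize hμ]
  have hm : Tendsto (fun n => (((μs n).mass : ℝ) : ℂ)⁻¹) atTop (𝓝 ((μ.mass : ℝ) : ℂ)⁻¹) := by
    refine Tendsto.inv₀ ?_ ?_
    · simp_rw [← e]
      exact h 0
    · exact_mod_cast (FiniteMeasure.mass_nonzero_iff μ).2 hμ
  refine (hm.mul (h t)).congr' ?_
  filter_upwards [hne] with n hn
  rw [charFun_normalize hn]

theorem charFun_withDensity_ofReal (ν : Measure ℝ) {g : ℝ → ℝ} (hg : Continuous g)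
    (hg0 : ∀ x, 0 ≤ g x) (t : ℝ) :
    charFun (ν.withDensity fun x => ENNReal.ofReal (g x)) t =
      ∫ x, (g x : ℂ) * Complex.exp (t * x * Complex.I) ∂ν := by
  rw [charFun_apply_real, integral_withDensity_eq_integral_toReal_smul (by fun_prop)
    (ae_of_all _ fun x => ENNReal.ofReal_lt_top)]
  simp_rw [ENNReal.toReal_ofReal (hg0 _), Complex.real_smul]

/-- Convergence of the Fourier transforms of `g ν_N`, with `g` positive on a large interval,
implies vague convergence of `ν_N` on that interval. -/
theorem tendsto_lintegral_of_tendsto_integral_mul_exp {νs : ℕ → Measure ℝ} {ν : Measure ℝ}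
    {g : ℝ → ℝ} (hg : Continuous g) (hg0 : ∀ x, 0 ≤ g x) {R : ℝ} (hgR : ∀ x, |x| ≤ R → 0 < g x)
    (hint : ∀ N, Integrable g (νs N)) (hint' : Integrable g ν) (hne : ∫ x, g x ∂ν ≠ 0)
    (h : ∀ t : ℝ, Tendsto (fun N => ∫ x, (g x : ℂ) * Complex.exp (t * x * Complex.I) ∂νs N) atTop
      (𝓝 (∫ x, (g x : ℂ) * Complex.exp (t * x * Complex.I) ∂ν)))
    {f : ℝ → NNReal} (hf : Continuous f) (hfR : ∀ x, R < |x| → f x = 0) :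
    Tendsto (fun N => ∫⁻ x, f x ∂νs N) atTop (𝓝 (∫⁻ x, f x ∂ν)) := by
  set μs : ℕ → FiniteMeasure ℝ := fun N => ⟨(νs N).withDensity fun x => ENNReal.ofReal (g x),
    isFiniteMeasure_withDensity_ofReal (hint N).2⟩ with hμs
  set μ : FiniteMeasure ℝ := ⟨ν.withDensity fun x => ENNReal.ofReal (g x),
    isFiniteMeasure_withDensity_ofReal hint'.2⟩ with hμ
  have hμ0 : μ ≠ 0 := by
    intro h0
    have h1 := charFun_withDensity_ofReal ν hg hg0 0
    have h2 : (ν.withDensity fun x => ENNReal.ofReal (g x)) = 0 := congrArg Subtype.val h0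
    rw [h2, charFun_zero_measure] at h1
    simp only [Complex.ofReal_zero, zero_mul, Complex.exp_zero, mul_one] at h1
    rw [integral_complex_ofReal] at h1
    exact hne (by exact_mod_cast h1.symm)
  have hlim : Tendsto μs atTop (𝓝 μ) := by
    refine tendsto_finiteMeasure_of_tendsto_charFun hμ0 fun t => ?_
    have e : ∀ N, charFun (μs N : Measure ℝ) t =
        ∫ x, (g x : ℂ) * Complex.exp (t * x * Complex.I) ∂νs N :=
      fun N => charFun_withDensity_ofReal (νs N) hg hg0 t
    have e' : charFun (μ : Measure ℝ) t = ∫ x, (g x : ℂ) * Complex.exp (t * x * Complex.I) ∂ν :=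
      charFun_withDensity_ofReal ν hg hg0 t
    simp_rw [e, e']
    exact h t
  obtain ⟨η, hη0, hη⟩ : ∃ η : ℝ, 0 < η ∧ ∀ x, |x| ≤ R → η ≤ g x := by
    rcases lt_or_ge R 0 with hR | hR
    · exact ⟨1, one_pos, fun x hx => absurd (hx.trans_lt hR) (not_lt.2 (abs_nonneg x))⟩
    · obtain ⟨x, hx, hm⟩ := (isCompact_Icc (a := -R) (b := R)).exists_isMinOn
        ⟨0, by simpa using hR⟩ hg.continuousOn
      exact ⟨g x, hgR x (abs_le.2 hx), fun y hy => hm (abs_le.1 hy)⟩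
  have hmax : ∀ x, (max (g x) η).toNNReal ≠ 0 := fun x =>
    (Real.toNNReal_pos.2 (lt_max_of_lt_right hη0)).ne'
  -- The test function should be f / g, but g may vanish outside [-R, R]. Replacing g by max(g, η)
  -- keeps the quotient continuous and changes nothing on [-R, R], outside which f is zero.
  have hq : Continuous fun x => f x / (max (g x) η).toNNReal :=
    hf.div₀ (continuous_real_toNNReal.comp (hg.max continuous_const)) hmax
  have hqs : HasCompactSupport fun x => f x / (max (g x) η).toNNReal := by
    refine HasCompactSupport.intro (isCompact_closedBall (0 : ℝ) R) fun x hx => ?_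
    rw [Metric.mem_closedBall, dist_zero_right, Real.norm_eq_abs, not_le] at hx
    rw [hfR x hx, zero_div]
  set q : BoundedContinuousFunction ℝ NNReal := ⟨⟨_, hq⟩,
    Metric.isBounded_range_iff.1 (hqs.isCompact_range hq).isBounded⟩ with hqdef
  have hlint : ∀ κ : Measure ℝ,
      ∫⁻ x, q x ∂(κ.withDensity fun x => ENNReal.ofReal (g x)) = ∫⁻ x, f x ∂κ := by
    intro κ
    rw [lintegral_withDensity_eq_lintegral_mul _ (by fun_prop)
      (by exact measurable_coe_nnreal_ennreal.comp q.continuous.measurable)]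
    refine lintegral_congr fun x => ?_
    change ((g x).toNNReal : ENNReal) * ((f x / (max (g x) η).toNNReal : NNReal) : ENNReal) = f x
    rw [← ENNReal.coe_mul, ENNReal.coe_inj]
    rcases le_or_gt |x| R with hx | hx
    · have hm := hmax x
      rw [max_eq_left (hη x hx)] at hm ⊢
      exact mul_div_cancel₀ _ hm
    · rw [hfR x hx, zero_div, mul_zero]
  have h1 := FiniteMeasure.tendsto_iff_forall_lintegral_tendsto.1 hlim q
  have e1 : ∀ N, ∫⁻ x, q x ∂(μs N : Measure ℝ) = ∫⁻ x, f x ∂νs N := fun N => hlint (νs N)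
  have e2 : ∫⁻ x, q x ∂(μ : Measure ℝ) = ∫⁻ x, f x ∂ν := hlint ν
  simp_rw [e1, e2] at h1
  exact h1

/-- Multiplying g by exp(itx) only translates its Fourier transform, so each product is again an
admissible test function, and its integrals are the required characteristic functions. -/
theorem tendsto_lintegral_averagedPairCorrelationMeasure (φ : Polynomial ℝ) (α β : ℝ)
    {K : ℕ → Finset ℤ} (hK : ∀ n, K n ⊆ allLevels n) (hd : ∀ n, n ≤ (K n).card)
    (h : FluctuationsVanish φ K (α, β)) {f : ℝ → NNReal} (hf : Continuous f) {R : ℝ}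
    (hfR : ∀ x, R < |x| → f x = 0) :
    Tendsto (fun N => ∫⁻ x, f x ∂averagedPairCorrelationMeasure φ α β K N) atTop
      (𝓝 (∫⁻ x, f x ∂poissonPairCorrelation)) := by
  -- The maximum with 0 ensures g(0) > 0, hence a nonzero limiting mass, even when R < 0.
  obtain ⟨g, hg, hg0, hgR, hgi, hgO, hgF⟩ := exists_bandlimited_pos (max R 0)
  have hgc : Continuous fun x => (g x : ℂ) := by fun_prop
  have hP : ∀ {E : Type} [NormedAddCommGroup E] {u : ℝ → E}, Integrable u →
      Integrable u poissonPairCorrelation := fun hu =>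
    (integrable_dirac (by simp)).add_measure hu
  refine tendsto_lintegral_of_tendsto_integral_mul_exp hg hg0
    (fun x hx => hgR x (hx.trans (le_max_left _ _))) (fun N => ?_) (hP hgi) ?_ (fun t => ?_) hf hfR
  · rcases Nat.eq_zero_or_pos N with rfl | hN
    · simp [averagedPairCorrelationMeasure]
    · exact (integrable_averagedPairCorrelationMeasure φ α β hd hN hgc hgO).re
  · rw [poissonPairCorrelation, integral_add_measure (integrable_dirac (by simp)) hgi,
      integral_dirac]
    have h1 := hgR 0 (by simp)
    have h2 : 0 ≤ ∫ x, g x := integral_nonneg hg0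
    linarith
  · have hexp : ∀ x : ℝ, ‖Complex.exp ((t : ℂ) * x * Complex.I)‖ = 1 := fun x => by
      rw [← Complex.ofReal_mul, Complex.norm_exp_ofReal_mul_I]
    set u : ℝ → ℂ := fun x => (g x : ℂ) * Complex.exp (t * x * Complex.I) with hu
    have huc : Continuous u := by fun_prop
    have hui : Integrable u := by
      refine hgi.mono huc.aestronglyMeasurable (ae_of_all _ fun x => ?_)
      rw [hu, norm_mul, hexp, mul_one, Complex.norm_real]
    have huO : u =O[cocompact ℝ] fun x => |x| ^ (-2 : ℝ) := by
      refine Asymptotics.IsBigO.trans (Asymptotics.IsBigO.of_bound 1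
        (Eventually.of_forall fun x => ?_)) hgO
      rw [hu, norm_mul, hexp, mul_one, one_mul]
    have huF : HasCompactSupport (FourierTransform.fourier u) :=
      hasCompactSupport_fourier_mul_exp hgF t
    simp_rw [integral_averagedPairCorrelationMeasure φ α β hd _ huc huO huF]
    rw [integral_poissonPairCorrelation hui]
    exact tendsto_averagedPairCorrelation φ α β hK hd h huc hui huF

/-! ### From vague convergence to compact intervals -/

theorem thickenedIndicator_Icc_eq_zero {ε : ℝ} (hε : 0 < ε) {a b x : ℝ}
    (hx : x ∉ Set.Ioo (a - ε) (b + ε)) : thickenedIndicator hε (Set.Icc a b) x = 0 := by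
  refine thickenedIndicator_zero hε _ fun h => hx ?_
  obtain ⟨y, hy, hxy⟩ := Metric.mem_thickening_iff.1 h
  rw [Real.dist_eq, abs_lt] at hxy
  exact ⟨by linarith [hy.1], by linarith [hy.2]⟩

theorem measure_Icc_le_lintegral_thickenedIndicator (κ : Measure ℝ) {ε : ℝ} (hε : 0 < ε)
    (a b : ℝ) : κ (Set.Icc a b) ≤ ∫⁻ x, thickenedIndicator hε (Set.Icc a b) x ∂κ := by
  rw [← lintegral_indicator_one measurableSet_Icc]
  refine lintegral_mono fun x => ?_
  by_cases hx : x ∈ Set.Icc a b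
  · rw [Set.indicator_of_mem hx, thickenedIndicator_one hε _ hx]
    simp
  · rw [Set.indicator_of_notMem hx]
    exact zero_le

theorem lintegral_thickenedIndicator_le_measure_Icc (κ : Measure ℝ) {ε : ℝ} (hε : 0 < ε)
    (a b : ℝ) :
    ∫⁻ x, thickenedIndicator hε (Set.Icc a b) x ∂κ ≤ κ (Set.Icc (a - ε) (b + ε)) := by
  rw [← lintegral_indicator_one measurableSet_Icc]
  refine lintegral_mono fun x => ?_
  by_cases hx : x ∈ Set.Icc (a - ε) (b + ε)
  · rw [Set.indicator_of_mem hx]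
    exact ENNReal.coe_le_one_iff.2 (thickenedIndicator_le_one hε _ x)
  · rw [thickenedIndicator_Icc_eq_zero hε fun h => hx (Set.Ioo_subset_Icc_self h)]
    simp

/-- The d pairs j = k with m = 0 each put mass 1 / d at 0. -/
theorem one_le_pairCorrelationMeasure_singleton_zero (φ : Polynomial ℝ) (α β : ℝ) (n : ℕ)
    {K : Finset ℤ} (hK : 0 < K.card) : 1 ≤ pairCorrelationMeasure φ α β n K {0} := by
  have h1 : ∀ j ∈ K, (1 : ENNReal) ≤ ∑ k ∈ K, (Measure.sum fun m : ℤ => Measure.dirac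
      ((K.card : ℝ) * (eigenphase φ α β n j - eigenphase φ α β n k + (m : ℝ)))) {0} := by
    intro j hj
    refine le_trans ?_ (Finset.single_le_sum (f := fun k => (Measure.sum fun m : ℤ =>
      Measure.dirac ((K.card : ℝ) * (eigenphase φ α β n j - eigenphase φ α β n k + (m : ℝ)))) {0})
      (fun _ _ => zero_le) hj)
    refine le_trans ?_ (Measure.le_sum _ (0 : ℤ) {0})
    simp
  rw [pairCorrelationMeasure, Measure.smul_apply, Measure.finsetSum_apply, smul_eq_mul]
  simp_rw [Measure.finsetSum_apply]
  have h2 : (K.card : ENNReal) ≠ 0 := by exact_mod_cast hK.ne'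
  calc (1 : ENNReal) = (K.card : ENNReal)⁻¹ * ∑ j ∈ K, 1 := by
        rw [Finset.sum_const, nsmul_eq_mul, mul_one,
          ENNReal.inv_mul_cancel h2 (ENNReal.natCast_ne_top _)]
    _ ≤ _ := by
        gcongr with j hj
        exact h1 j hj

theorem one_le_averagedPairCorrelationMeasure_singleton_zero (φ : Polynomial ℝ) (α β : ℝ)
    {K : ℕ → Finset ℤ} (hd : ∀ n, n ≤ (K n).card) {N : ℕ} (hN : 1 ≤ N) :
    1 ≤ averagedPairCorrelationMeasure φ α β K N {0} := by
  rw [averagedPairCorrelationMeasure, Measure.smul_apply, Measure.finsetSum_apply, smul_eq_mul]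
  have h2 : (N : ENNReal) ≠ 0 := by exact_mod_cast (by omega : N ≠ 0)
  calc (1 : ENNReal) = (N : ENNReal)⁻¹ * ∑ n ∈ Finset.Icc 1 N, 1 := by
        rw [Finset.sum_const, Nat.card_Icc, Nat.add_sub_cancel, nsmul_eq_mul, mul_one,
          ENNReal.inv_mul_cancel h2 (ENNReal.natCast_ne_top _)]
    _ ≤ _ := by
        gcongr with n hn
        exact one_le_pairCorrelationMeasure_singleton_zero φ α β n
          ((Finset.mem_Icc.1 hn).1.trans (hd n))

theorem poissonPairCorrelation_Icc_of_mem {a b : ℝ} (h : (0 : ℝ) ∈ Set.Icc a b) :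
    poissonPairCorrelation (Set.Icc a b) = 1 + ENNReal.ofReal (b - a) := by
  rw [poissonPairCorrelation, Measure.add_apply, Measure.dirac_apply_of_mem h, Real.volume_Icc]

theorem poissonPairCorrelation_Icc_of_notMem {a b : ℝ} (h : (0 : ℝ) ∉ Set.Icc a b) :
    poissonPairCorrelation (Set.Icc a b) = ENNReal.ofReal (b - a) := by
  rw [poissonPairCorrelation, Measure.add_apply, Measure.dirac_apply' _ measurableSet_Icc,
    Set.indicator_of_notMem h, zero_add, Real.volume_Icc]

theorem ofReal_le_lintegral_thickenedIndicator {ε : ℝ} (hε : 0 < ε) (a b : ℝ) :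
    ENNReal.ofReal (b - a) ≤
      ∫⁻ x, thickenedIndicator hε (Set.Icc a b) x ∂poissonPairCorrelation := by
  refine le_trans ?_ (measure_Icc_le_lintegral_thickenedIndicator _ hε a b)
  rw [poissonPairCorrelation, Measure.add_apply, Real.volume_Icc]
  exact le_add_self

theorem tendsto_const_add_ofReal (c : ENNReal) (x r : ℝ) :
    Tendsto (fun ε : ℝ => c + ENNReal.ofReal (x + r * ε)) (𝓝[>] 0)
      (𝓝 (c + ENNReal.ofReal x)) := by
  refine Tendsto.const_add c (ENNReal.tendsto_ofReal ?_)
  have h1 : Tendsto (fun ε : ℝ => x + r * ε) (𝓝 0) (𝓝 (x + r * 0)) :=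
    (by fun_prop : Continuous fun ε : ℝ => x + r * ε).tendsto 0
  rw [mul_zero, add_zero] at h1
  exact h1.mono_left nhdsWithin_le_nhds

/-- Vague convergence to the Poisson pair correlation, with an atom of mass at least one at `0`
along the way, implies convergence on all compact intervals. -/
theorem tendsto_measure_Icc_of_tendsto_lintegral {κ : ℕ → Measure ℝ}
    (hκ : ∀ f : ℝ → NNReal, Continuous f → ∀ R : ℝ, (∀ x, R < |x| → f x = 0) →
      Tendsto (fun N => ∫⁻ x, f x ∂κ N) atTop (𝓝 (∫⁻ x, f x ∂poissonPairCorrelation)))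
    (h0 : ∀ᶠ N in atTop, 1 ≤ κ N {0}) (a b : ℝ) :
    Tendsto (fun N => κ N (Set.Icc a b)) atTop (𝓝 (poissonPairCorrelation (Set.Icc a b))) := by
  rcases lt_or_ge b a with hab | hab
  · simp [Set.Icc_eq_empty (not_le.2 hab)]
  have hT : ∀ {ε : ℝ} (hε : 0 < ε) (a b : ℝ),
      Tendsto (fun N => ∫⁻ x, thickenedIndicator hε (Set.Icc a b) x ∂κ N) atTop
        (𝓝 (∫⁻ x, thickenedIndicator hε (Set.Icc a b) x ∂poissonPairCorrelation)) := by
    intro ε hε a b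
    refine hκ _ (thickenedIndicator hε (Set.Icc a b)).continuous (max |a - ε| |b + ε|) fun x hx =>
      thickenedIndicator_Icc_eq_zero hε fun hx' => absurd hx (not_lt.2 ?_)
    exact abs_le_max_abs_abs hx'.1.le hx'.2.le
  have hupper : ∀ ε : ℝ, 0 < ε → limsup (fun N => κ N (Set.Icc a b)) atTop ≤
      poissonPairCorrelation (Set.Icc (a - ε) (b + ε)) := by
    intro ε hε
    refine le_trans ?_ (lintegral_thickenedIndicator_le_measure_Icc _ hε a b)
    rw [← (hT hε a b).limsup_eq]
    exact limsup_le_limsup (Eventually.of_forall fun N =>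
      measure_Icc_le_lintegral_thickenedIndicator _ hε a b)
  by_cases hmem : (0 : ℝ) ∈ Set.Icc a b
  · rw [poissonPairCorrelation_Icc_of_mem hmem]
    refine tendsto_of_le_liminf_of_limsup_le ?_ ?_
    -- If 0 is an endpoint, approximation from inside misses the atom. So the mass at 0 is bounded
    -- below separately, and vague convergence is used only on [a, -ε] and [ε, b]. The tested
    -- intervals there lose 3ε each, hence -6ε.
    · refine le_of_tendsto (tendsto_const_add_ofReal 1 (b - a) (-6)) ?_
      filter_upwards [self_mem_nhdsWithin] with ε (hε : 0 < ε)
      have h1 := ((hT hε (a + ε) (-(2 * ε))).add (hT hε (2 * ε) (b - ε))).const_add 1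
      calc 1 + ENNReal.ofReal (b - a + -6 * ε)
          ≤ 1 + (ENNReal.ofReal (-(2 * ε) - (a + ε)) + ENNReal.ofReal (b - ε - 2 * ε)) := by
            gcongr
            refine le_trans (le_of_eq ?_) ENNReal.ofReal_add_le
            ring_nf
        _ ≤ _ := add_le_add_right (add_le_add
            (ofReal_le_lintegral_thickenedIndicator hε (a + ε) (-(2 * ε)))
            (ofReal_le_lintegral_thickenedIndicator hε (2 * ε) (b - ε))) 1
        _ = _ := h1.liminf_eq.symm
        _ ≤ _ := by
            refine liminf_le_liminf ?_
            filter_upwards [h0] with N hN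
            have h2 := lintegral_thickenedIndicator_le_measure_Icc (κ N) hε (a + ε) (-(2 * ε))
            have h3 := lintegral_thickenedIndicator_le_measure_Icc (κ N) hε (2 * ε) (b - ε)
            rw [add_sub_cancel_right] at h2
            rw [sub_add_cancel] at h3
            refine (add_le_add hN (add_le_add h2 h3)).trans ?_
            rw [← measure_union _ measurableSet_Icc, ← measure_union]
            · refine measure_mono (Set.union_subset ?_ (Set.union_subset ?_ ?_))
              · simpa using hmem
              · exact Set.Icc_subset_Icc_right (by linarith [hmem.2])
              · exact Set.Icc_subset_Icc_left (by linarith [hmem.1])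
            · rw [Set.disjoint_singleton_left, Set.mem_union, Set.mem_Icc, Set.mem_Icc]
              rintro (h | h) <;> linarith [h.1, h.2]
            · exact measurableSet_Icc.union measurableSet_Icc
            · rw [Set.disjoint_left]
              intro x hx hx'
              linarith [hx.2, hx'.1]
    · refine ge_of_tendsto (tendsto_const_add_ofReal 1 (b - a) 2) ?_
      filter_upwards [self_mem_nhdsWithin] with ε (hε : 0 < ε)
      refine (hupper ε hε).trans (le_of_eq ?_)
      rw [poissonPairCorrelation_Icc_of_mem ⟨by linarith [hmem.1], by linarith [hmem.2]⟩]
      ring_nf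
  · rw [poissonPairCorrelation_Icc_of_notMem hmem, ← zero_add (ENNReal.ofReal (b - a))]
    refine tendsto_of_le_liminf_of_limsup_le ?_ ?_
    · refine le_of_tendsto (tendsto_const_add_ofReal 0 (b - a) (-2)) ?_
      filter_upwards [self_mem_nhdsWithin] with ε (hε : 0 < ε)
      have h1 := hT hε (a + ε) (b - ε)
      calc 0 + ENNReal.ofReal (b - a + -2 * ε) = ENNReal.ofReal (b - ε - (a + ε)) := by
            rw [zero_add]
            ring_nf
        _ ≤ _ := ofReal_le_lintegral_thickenedIndicator hε (a + ε) (b - ε)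
        _ = _ := h1.liminf_eq.symm
        _ ≤ _ := by
            refine liminf_le_liminf (Eventually.of_forall fun N => ?_)
            have h2 := lintegral_thickenedIndicator_le_measure_Icc (κ N) hε (a + ε) (b - ε)
            rwa [add_sub_cancel_right, sub_add_cancel] at h2
    -- Enlargements by less than the distance δ from 0 to [a, b] still avoid the atom.
    · obtain ⟨δ, hδ0, hδ⟩ : ∃ δ : ℝ, 0 < δ ∧ ∀ ε < δ, (0 : ℝ) ∉ Set.Icc (a - ε) (b + ε) := by
        rcases lt_or_ge 0 a with ha | ha
        · exact ⟨a, ha, fun ε hε h => by linarith [h.1]⟩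
        · have hb : b < 0 := lt_of_not_ge fun hb => hmem ⟨ha, hb⟩
          exact ⟨-b, by linarith, fun ε hε h => by linarith [h.2]⟩
      refine ge_of_tendsto (tendsto_const_add_ofReal 0 (b - a) 2) ?_
      filter_upwards [Ioo_mem_nhdsGT hδ0] with ε hε
      refine (hupper ε hε.1).trans (le_of_eq ?_)
      rw [poissonPairCorrelation_Icc_of_notMem (hδ ε hε.2), zero_add]
      ring_nf

/-! ### Conclusion for the two families of levels -/

theorem convergesToPoisson_of_fluctuationsVanish (φ : Polynomial ℝ) {K : ℕ → Finset ℤ}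
    (hK : ∀ n, K n ⊆ allLevels n) (hd : ∀ n, n ≤ (K n).card) {p : ℝ × ℝ}
    (h : FluctuationsVanish φ K p) : ConvergesToPoisson φ K p.1 p.2 := by
  refine ⟨fun f hf hfi hfc => ?_, tendsto_measure_Icc_of_tendsto_lintegral
    (fun f hf R hfR => tendsto_lintegral_averagedPairCorrelationMeasure φ p.1 p.2 hK hd h hf hfR) ?_⟩
  · rw [integral_poissonPairCorrelation hfi]
    exact tendsto_averagedPairCorrelation φ p.1 p.2 hK hd h hf hfi hfc
  · filter_upwards [eventually_ge_atTop 1] with N hN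
    exact one_le_averagedPairCorrelationMeasure_singleton_zero φ p.1 p.2 hd hN

theorem positiveLevels_subset_allLevels (n : ℕ) : positiveLevels n ⊆ allLevels n :=
  Finset.Icc_subset_Icc_left (by omega)

theorem le_card_positiveLevels (n : ℕ) : n ≤ (positiveLevels n).card := by
  rw [positiveLevels, Int.card_Icc]
  omega

theorem le_card_allLevels (n : ℕ) : n ≤ (allLevels n).card :=
  (le_card_positiveLevels n).trans (Finset.card_le_card (positiveLevels_subset_allLevels n))

end

end QuantumMap

theorem mainTheorem1 (φ : Polynomial ℝ)
    (hφ : ∀ x ∈ Set.Icc (-1 : ℝ) 1, φ.derivative.derivative.eval x ≠ 0) :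
    ∀ᵐ p : ℝ × ℝ,
      QuantumMap.ConvergesToPoisson φ QuantumMap.positiveLevels p.1 p.2 ∧
        QuantumMap.ConvergesToPoisson φ QuantumMap.allLevels p.1 p.2 := by
  filter_upwards [QuantumMap.ae_fluctuationsVanish hφ QuantumMap.positiveLevels_subset_allLevels,
    QuantumMap.ae_fluctuationsVanish hφ (K := QuantumMap.allLevels) fun _ => subset_rfl]
    with p h1 h2
  exact ⟨QuantumMap.convergesToPoisson_of_fluctuationsVanish φ
      QuantumMap.positiveLevels_subset_allLevels QuantumMap.le_card_positiveLevels h1,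
    QuantumMap.convergesToPoisson_of_fluctuationsVanish φ (fun _ => subset_rfl)
      QuantumMap.le_card_allLevels h2⟩
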